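/- Write $\mathbb N=\{1,2,\dots\}$ and $\mathbb N_0=\mathbb N\cup\{0\}$. Let $s$ be the Fréchet space of all $\xi\in\mathbb C^{\mathbb N}$ with $|\xi|_q:=\big(\sum_{j}|\xi_j|^2j^{2q}\big)^{1/2}<\infty$ for all $q\in\mathbb N_0$, with the topology given by the norms $|\cdot|_q$, and let $s'$ be the space of all $\eta\in\mathbb C^{\mathbb N}$ with $|\eta|'_q:=\big(\sum_j|\eta_j|^2j^{-2q}\big)^{1/2}<\infty$ for some $q\in\mathbb N_0$, with the locally convex inductive limit topology given by the norms $|\cdot|'_q$. Put $\langle\eta,\xi\rangle:=\sum_j\eta_j\overline{\xi_j}$. Let $\mathcal L(s',s)$ be the space of continuous linear operators from $s'$ to $s$ with the topology of uniform convergence on bounded subsets of $s'$; via $s\hookrightarrow\ell_2\hookrightarrow s'$ it embeds into $\mathcal L(\ell_2)$ and carries the product and the involution (hermitian adjoint) of $\mathcal L(\ell_2)$. For an infinite-dimensional closed commutative ${}^*$-subalgebra $E$ of $\mathcal L(s',s)$, an enumeration $(P_k)_{k\in\mathbb N}$, without repetition, of all nonzero minimal projections (self-adjoint idempotents) of $E$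 is called a canonical basis of $E$. For a matrix $A=(a_{k,q})_{k\in\mathbb N,q\in\mathbb N_0}$ with entries $\ge 1$ and non-decreasing in $q$, let $\lambda^\infty(A)$ be the algebra of all $\xi\in\mathbb C^{\mathbb N}$ with $\sup_k|\xi_k|a_{k,q}<\infty$ for all $q$, with the topology given by these seminorms and with coordinatewise multiplication and conjugation; $e_k$ denotes its $k$-th unit vector. An isomorphism of Fréchet ${}^*$-algebras is a ${}^*$-algebra isomorphism that is a homeomorphism. A sequence $(P_k)$ in $E$ is a Schauder basis of $E$ if each $x\in E$ has a unique convergent expansion $x=\sum_kc_kP_k$ with $c_k\in\mathbb C$. (1) For every infinite-dimensional closed commutative ${}^*$-subalgebra $E$ of $\mathcal L(s',s)$ there are a sequence $(f_j)_{j\in\mathbb N}\subset s$, orthonormal in $\ell_2$, and a family $(\mathcal N_k)_{k\in\mathbb N}$ of finite nonempty pairwise disjoint subsets of $\mathbb N$ such that $\big(\sum_{j\in\mathcal N_k}\langle\cdot,f_j\rangle f_j\big)_{k\in\mathbb N}$ is a canonical basis of $E$, is a Schauder basis of $E$, and $$E\cong\lambda^\infty\Big(\max_{j\in\mathcal N_k}|f_j|_q\Big)$$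 as Fréchet ${}^*$-algebras, by an isomorphism with $\sum_{j\in\mathcal N_k}\langle\cdot,f_j\rangle f_j\mapsto e_k$ for all $k\in\mathbb N$. (2) In fact, if $E$ is an infinite-dimensional closed commutative ${}^*$-subalgebra of $\mathcal L(s',s)$, $(f_j)_{j\in\mathbb N}\subset s$ is any orthonormal sequence and $(\mathcal N_k)_{k\in\mathbb N}$ is any family of finite nonempty pairwise disjoint subsets of $\mathbb N$ such that $\big(\sum_{j\in\mathcal N_k}\langle\cdot,f_j\rangle f_j\big)_{k}$ is a canonical basis of $E$, then it is a Schauder basis of $E$ and $E\cong\lambda^\infty(\max_{j\in\mathcal N_k}|f_j|_q)$ as Fréchet ${}^*$-algebras by an isomorphism with $\sum_{j\in\mathcal N_k}\langle\cdot,f_j\rangle f_j\mapsto e_k$ for all $k$. (3) Conversely, if $(f_j)_{j\in\mathbb N}\subset s$ is an orthonormal sequence and $(\mathcal N_k)_{k\in\mathbb N}$ is a family of finite nonempty pairwise disjoint subsets of $\mathbb N$, then there is an infinite-dimensional closed commutative ${}^*$-subalgebra $E$ of $\mathcal L(s',s)$ for which $\big(\sum_{j\in\mathcal N_k}\langle\cdot,f_j\rangle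 f_j\big)_k$ is a canonical basis and a Schauder basis, and $\lambda^\infty(\max_{j\in\mathcal N_k}|f_j|_q)$ is isomorphic to $E$ as a Fréchet ${}^*$-algebra by an isomorphism with $e_k\mapsto\sum_{j\in\mathcal N_k}\langle\cdot,f_j\rangle f_j$ for all $k$. -/

import Mathlib

open scoped ComplexConjugate

noncomputable section

namespace SmoothOperators

/-! ### Weighted `ℓ²` norms

Sequences are indexed by `ℕ = {0, 1, 2, …}`; the entry with index `j` here is the entry with
index `j + 1` in the convention `ℕ = {1, 2, …}`, so the weight `j ^ t` becomes `(j + 1) ^ t`. -/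

/-- The weighted `ℓ²` sum of `ξ` with exponent `t` is finite. -/
def SqSummable (t : ℤ) (ξ : ℕ → ℂ) : Prop :=
  Summable fun j : ℕ => ‖ξ j‖ ^ 2 * ((j : ℝ) + 1) ^ (2 * t)

/-- The weighted `ℓ²` norm with exponent `t`. -/
def wNorm (t : ℤ) (ξ : ℕ → ℂ) : ℝ :=
  √(∑' j : ℕ, ‖ξ j‖ ^ 2 * ((j : ℝ) + 1) ^ (2 * t))

/-- The Hilbert space of square summable sequences. -/
abbrev L2 : Type := lp (fun _ : ℕ => ℂ) 2

/-- Multiplication of a sequence by the weight. -/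
def weighted (t : ℤ) (ξ : ℕ → ℂ) : ℕ → ℂ := fun j => ((((j : ℝ) + 1) ^ t : ℝ) : ℂ) * ξ j

theorem norm_weighted_sq (t : ℤ) (ξ : ℕ → ℂ) (j : ℕ) :
    ‖weighted t ξ j‖ ^ 2 = ‖ξ j‖ ^ 2 * ((j : ℝ) + 1) ^ (2 * t) := by
  have h : (0 : ℝ) < (j : ℝ) + 1 := by positivity
  have h2 : ((j : ℝ) + 1) ^ (2 * t) = (((j : ℝ) + 1) ^ t) ^ 2 := by
    rw [mul_comm, zpow_mul]; norm_cast
  rw [weighted, norm_mul, Complex.norm_real, Real.norm_of_nonneg (by positivity), mul_pow, h2,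
    mul_comm]

theorem sqSummable_iff (t : ℤ) (ξ : ℕ → ℂ) : SqSummable t ξ ↔ Memℓp (weighted t ξ) 2 := by
  rw [memℓp_gen_iff (by norm_num), SqSummable]
  refine summable_congr fun j => ?_
  rw [← norm_weighted_sq]
  norm_num

/-- The weighted sequence as an element of `ℓ²`. -/
def weightedL2 (t : ℤ) (ξ : ℕ → ℂ) (h : SqSummable t ξ) : L2 :=
  ⟨weighted t ξ, (sqSummable_iff t ξ).1 h⟩

theorem wNorm_eq_norm (t : ℤ) (ξ : ℕ → ℂ) (h : SqSummable t ξ) :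
    wNorm t ξ = ‖weightedL2 t ξ h‖ := by
  rw [lp.norm_eq_tsum_rpow (by norm_num), wNorm, Real.sqrt_eq_rpow]
  have h2 : (2 : ENNReal).toReal = 2 := by norm_num
  rw [h2]
  congr 1
  refine tsum_congr fun j => ?_
  rw [← norm_weighted_sq, ← Real.rpow_natCast]
  rfl

theorem wNorm_nonneg (t : ℤ) (ξ : ℕ → ℂ) : 0 ≤ wNorm t ξ := Real.sqrt_nonneg _

theorem SqSummable.zero (t : ℤ) : SqSummable t 0 := by
  simp [SqSummable, summable_zero]

theorem weighted_add (t : ℤ) (ξ η : ℕ → ℂ) :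
    weighted t (ξ + η) = weighted t ξ + weighted t η := by
  funext j; simp [weighted, mul_add]

theorem weighted_smul (t : ℤ) (c : ℂ) (ξ : ℕ → ℂ) : weighted t (c • ξ) = c • weighted t ξ := by
  funext j; simp only [weighted, Pi.smul_apply, smul_eq_mul]; ring

theorem SqSummable.add {t : ℤ} {ξ η : ℕ → ℂ} (h : SqSummable t ξ) (h' : SqSummable t η) :
    SqSummable t (ξ + η) := by
  rw [sqSummable_iff] at *
  rw [weighted_add]
  exact h.add h'

theorem SqSummable.smul {t : ℤ} {ξ : ℕ → ℂ} (c : ℂ) (h : SqSummable t ξ) :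
    SqSummable t (c • ξ) := by
  rw [sqSummable_iff] at *
  rw [weighted_smul]
  exact h.const_smul c

theorem wNorm_add_le {t : ℤ} {ξ η : ℕ → ℂ} (h : SqSummable t ξ) (h' : SqSummable t η) :
    wNorm t (ξ + η) ≤ wNorm t ξ + wNorm t η := by
  rw [wNorm_eq_norm t _ (h.add h'), wNorm_eq_norm t _ h, wNorm_eq_norm t _ h']
  have : weightedL2 t (ξ + η) (h.add h') = weightedL2 t ξ h + weightedL2 t η h' :=
    Subtype.ext (weighted_add t ξ η)
  rw [this]
  exact norm_add_le _ _

theorem wNorm_smul (t : ℤ) (c : ℂ) (ξ : ℕ → ℂ) : wNorm t (c • ξ) = ‖c‖ * wNorm t ξ := by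
  have : ∀ j : ℕ, ‖(c • ξ) j‖ ^ 2 * ((j : ℝ) + 1) ^ (2 * t)
      = ‖c‖ ^ 2 * (‖ξ j‖ ^ 2 * ((j : ℝ) + 1) ^ (2 * t)) := fun j => by
    simp only [Pi.smul_apply, smul_eq_mul, norm_mul]; ring
  rw [wNorm, tsum_congr this, tsum_mul_left, Real.sqrt_mul (by positivity),
    Real.sqrt_sq (norm_nonneg c), wNorm]

theorem weight_mono {t u : ℤ} (htu : t ≤ u) (j : ℕ) :
    ((j : ℝ) + 1) ^ (2 * t) ≤ ((j : ℝ) + 1) ^ (2 * u) :=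
  zpow_le_zpow_right₀ (by simp) (by omega)

theorem SqSummable.mono {t u : ℤ} (htu : t ≤ u) {ξ : ℕ → ℂ} (h : SqSummable u ξ) :
    SqSummable t ξ :=
  Summable.of_nonneg_of_le (fun j => by positivity)
    (fun j => mul_le_mul_of_nonneg_left (weight_mono htu j) (by positivity)) h

theorem wNorm_mono {t u : ℤ} (htu : t ≤ u) {ξ : ℕ → ℂ} (h : SqSummable u ξ) :
    wNorm t ξ ≤ wNorm u ξ :=
  Real.sqrt_le_sqrt (Summable.tsum_le_tsum
    (fun j => mul_le_mul_of_nonneg_left (weight_mono htu j) (by positivity)) (h.mono htu) h)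

/-! ### The pairing `⟨η, ξ⟩ = ∑ η_j conj(ξ_j)` -/

/-- The pairing `∑ η_j conj(ξ_j)`. -/
def pairing (η ξ : ℕ → ℂ) : ℂ := ∑' j : ℕ, η j * conj (ξ j)

theorem pairing_term {t : ℤ} (η ξ : ℕ → ℂ) (j : ℕ) :
    inner ℂ (weighted t ξ j) (weighted (-t) η j) = η j * conj (ξ j) := by
  have h : ((((j : ℝ) + 1) ^ t : ℝ) : ℂ) ≠ 0 := by
    have : (0 : ℝ) < ((j : ℝ) + 1) ^ t := by positivity
    exact_mod_cast this.ne'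
  simp only [weighted, RCLike.inner_apply, map_mul, Complex.conj_ofReal, zpow_neg,
    Complex.ofReal_inv]
  field_simp

theorem summable_pairing {t : ℤ} {η ξ : ℕ → ℂ} (hη : SqSummable (-t) η) (hξ : SqSummable t ξ) :
    Summable fun j : ℕ => η j * conj (ξ j) := by
  have := lp.summable_inner (𝕜 := ℂ) (weightedL2 t ξ hξ) (weightedL2 (-t) η hη)
  exact this.congr fun j => (pairing_term η ξ j)

theorem norm_pairing_le {t : ℤ} {η ξ : ℕ → ℂ} (hη : SqSummable (-t) η) (hξ : SqSummable t ξ) :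
    ‖pairing η ξ‖ ≤ wNorm (-t) η * wNorm t ξ := by
  have h : pairing η ξ = inner ℂ (weightedL2 t ξ hξ) (weightedL2 (-t) η hη) := by
    rw [lp.inner_eq_tsum]
    exact tsum_congr fun j => (pairing_term η ξ j).symm
  rw [h, wNorm_eq_norm _ _ hη, wNorm_eq_norm _ _ hξ, mul_comm]
  exact norm_inner_le_norm _ _

/-! ### The space `s` of rapidly decreasing sequences -/

/-- The rapidly decreasing sequences, as a linear subspace of `ℂ^ℕ`. -/
def rapidSubmodule : Submodule ℂ (ℕ → ℂ) where
  carrier := {ξ | ∀ q : ℕ, SqSummable q ξ}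
  zero_mem' := fun q => SqSummable.zero q
  add_mem' := fun h h' q => (h q).add (h' q)
  smul_mem' := fun c _ h q => (h q).smul c

/-- The space `s`. It is a type of its own because its topology is not the topology of
coordinatewise convergence. -/
def SSpace : Type := rapidSubmodule

instance : AddCommGroup SSpace := inferInstanceAs (AddCommGroup rapidSubmodule)
instance : Module ℂ SSpace := inferInstanceAs (Module ℂ rapidSubmodule)
instance : CoeFun SSpace (fun _ => ℕ → ℂ) := ⟨fun ξ => ξ.1⟩

/-- The norm `|ξ|_q = (∑ |ξ_j|² j^{2q})^{1/2}` on `s`. -/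
def sNorm : SeminormFamily ℂ SSpace ℕ := fun q =>
  Seminorm.of (fun ξ => wNorm q ξ) (fun ξ η => wNorm_add_le (ξ.2 q) (η.2 q))
    (fun c ξ => wNorm_smul q c ξ)

instance : TopologicalSpace SSpace := sNorm.moduleFilterBasis.topology

theorem withSeminorms_sNorm : WithSeminorms sNorm := ⟨rfl⟩

instance : IsTopologicalAddGroup SSpace := withSeminorms_sNorm.topologicalAddGroup
instance : ContinuousSMul ℂ SSpace := withSeminorms_sNorm.continuousSMul

/-! ### The space `s'` of slowly increasing sequences -/

/-- The slowly increasing sequences, as a linear subspace of `ℂ^ℕ`. -/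
def slowSubmodule : Submodule ℂ (ℕ → ℂ) where
  carrier := {η | ∃ q : ℕ, SqSummable (-q) η}
  zero_mem' := ⟨0, SqSummable.zero _⟩
  add_mem' := by
    rintro η θ ⟨q, h⟩ ⟨r, h'⟩
    exact ⟨max q r, (h.mono (by push_cast; omega)).add (h'.mono (by push_cast; omega))⟩
  smul_mem' := fun c _ ⟨q, h⟩ => ⟨q, h.smul c⟩

/-- The space `s'`. -/
def SDual : Type := slowSubmodule

instance : AddCommGroup SDual := inferInstanceAs (AddCommGroup slowSubmodule)
instance : Module ℂ SDual := inferInstanceAs (Module ℂ slowSubmodule)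
instance : CoeFun SDual (fun _ => ℕ → ℂ) := ⟨fun ξ => ξ.1⟩

/-- The seminorms on `s'` whose restriction to each step
`{η | |η|'_q < ∞}` is continuous with respect to the norm `|·|'_q` of the step. -/
def StepContinuousSeminorm : Type :=
  {p : Seminorm ℂ SDual //
    ∀ q : ℕ, ∃ C : ℝ, ∀ η : SDual, SqSummable (-q) η → p η ≤ C * wNorm (-q) η}

/-- The family of all step-continuous seminorms. -/
def sDualSeminorms : SeminormFamily ℂ SDual StepContinuousSeminorm := fun p => p.1

/-- The inductive limit topology on `s'`, i.e. the finest locally convex topology for which the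
inclusions of all the steps are continuous. -/
instance : TopologicalSpace SDual := sDualSeminorms.moduleFilterBasis.topology

theorem withSeminorms_sDual : WithSeminorms sDualSeminorms := ⟨rfl⟩

instance : IsTopologicalAddGroup SDual := withSeminorms_sDual.topologicalAddGroup
instance : ContinuousSMul ℂ SDual := withSeminorms_sDual.continuousSMul

/-! ### The embeddings `s ↪ ℓ² ↪ s'` -/

theorem sqSummable_L2 (ξ : L2) : SqSummable 0 ξ := by
  rw [sqSummable_iff]
  have : weighted 0 ξ = ξ := by funext j; simp [weighted]
  rw [this]
  exact ξ.2

theorem wNorm_L2 (ξ : L2) : wNorm 0 ξ = ‖ξ‖ := by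
  rw [wNorm_eq_norm _ _ (sqSummable_L2 ξ)]
  congr 1
  exact Subtype.ext (by funext j; simp [weightedL2, weighted])

theorem memLp_SSpace (ξ : SSpace) : Memℓp (ξ : ℕ → ℂ) 2 := by
  have := (sqSummable_iff 0 ξ).1 (by simpa using ξ.2 0)
  have h : weighted 0 ξ = ξ := by funext j; simp [weighted]
  rwa [h] at this

/-- The inclusion of `s` into `ℓ²`. -/
def j₁ : SSpace →L[ℂ] L2 where
  toFun ξ := ⟨ξ.1, memLp_SSpace ξ⟩
  map_add' _ _ := rfl
  map_smul' _ _ := rfl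
  cont := by
    let g : SSpace →ₗ[ℂ] L2 :=
      { toFun := fun ξ => ⟨ξ.1, memLp_SSpace ξ⟩
        map_add' := fun _ _ => rfl
        map_smul' := fun _ _ => rfl }
    refine WithSeminorms.continuous_normedSpace_rng (p := sNorm) L2 withSeminorms_sNorm g
      ⟨{0}, 1, fun ξ => ?_⟩
    simp only [Finset.sup_singleton, one_smul]
    exact (wNorm_L2 (g ξ)).symm.le

/-- The inclusion of `ℓ²` into `s'`. -/
def j₂ : L2 →L[ℂ] SDual where
  toFun ξ := ⟨ξ, 0, by simpa using sqSummable_L2 ξ⟩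
  map_add' _ _ := rfl
  map_smul' _ _ := rfl
  cont := by
    let g : L2 →ₗ[ℂ] SDual :=
      { toFun := fun ξ => ⟨ξ, 0, by simpa using sqSummable_L2 ξ⟩
        map_add' := fun _ _ => rfl
        map_smul' := fun _ _ => rfl }
    refine WithSeminorms.continuous_normedSpace_dom (q := sDualSeminorms) L2 withSeminorms_sDual g
      fun p => ?_
    obtain ⟨C, hC⟩ := p.2 0
    refine ⟨⟨max C 0, le_max_right _ _⟩, fun ξ => ?_⟩
    have hz : (-((0 : ℕ) : ℤ)) = 0 := by simp
    rw [hz] at hC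
    have h := hC (g ξ) (sqSummable_L2 ξ)
    have h2 : wNorm 0 (g ξ) = ‖ξ‖ := wNorm_L2 ξ
    rw [h2] at h
    exact h.trans (mul_le_mul_of_nonneg_right (le_max_left _ _) (norm_nonneg _))

/-! ### The algebra `L(s', s)` of smooth operators -/

/-- The space `L(s', s)` of continuous linear operators from `s'` to `s`, with the topology
of uniform convergence on bounded subsets of `s'` (the default topology on `→L`). -/
abbrev SmoothOp : Type := SDual →L[ℂ] SSpace

/-- A linear map `s' → s` is continuous as soon as it is bounded from each step of `s'` to each of
the normed spaces defining `s`. -/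
theorem continuous_of_bounds (g : SDual →ₗ[ℂ] SSpace)
    (h : ∀ q r : ℕ, ∃ C : ℝ, ∀ η : SDual, SqSummable (-r) η →
      wNorm q (g η) ≤ C * wNorm (-r) η) : Continuous g := by
  refine WithSeminorms.continuous_of_continuous_comp withSeminorms_sNorm g fun q => ?_
  exact withSeminorms_sDual.continuous_seminorm
    (⟨(sNorm q).comp g, fun r => h q r⟩ : StepContinuousSeminorm)

/-- Conversely, continuous operators satisfy these bounds. -/
theorem exists_bound (x : SmoothOp) (q r : ℕ) : ∃ C : ℝ, 0 ≤ C ∧ ∀ η : SDual,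
    SqSummable (-r) η → wNorm q (x η) ≤ C * wNorm (-r) η := by
  have hc : Continuous ((sNorm q).comp (x : SDual →ₗ[ℂ] SSpace)) :=
    (withSeminorms_sNorm.continuous_seminorm q).comp x.continuous
  obtain ⟨s, C, -, hC⟩ := Seminorm.bound_of_continuous withSeminorms_sDual _ hc
  have hs : ∀ s : Finset StepContinuousSeminorm, ∃ D : ℝ, 0 ≤ D ∧ ∀ η : SDual,
      SqSummable (-r) η → (s.sup sDualSeminorms) η ≤ D * wNorm (-r) η := by
    classical
    intro s
    induction s using Finset.induction_on with
    | empty => exact ⟨0, le_rfl, fun η _ => by simp⟩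
    | insert p s _ ih =>
      obtain ⟨D, hD, h⟩ := ih
      obtain ⟨D', h'⟩ := p.2 r
      refine ⟨max D D', hD.trans (le_max_left _ _), fun η hη => ?_⟩
      rw [Finset.sup_insert]
      refine max_le ?_ ?_
      · exact (h' η hη).trans (mul_le_mul_of_nonneg_right (le_max_right _ _) (wNorm_nonneg _ _))
      · exact (h η hη).trans (mul_le_mul_of_nonneg_right (le_max_left _ _) (wNorm_nonneg _ _))
  obtain ⟨D, hD, h⟩ := hs s
  refine ⟨C * D, by positivity, fun η hη => ?_⟩
  have h1 : wNorm q (x η) ≤ C * (s.sup sDualSeminorms) η := hC η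
  rw [mul_assoc]
  exact h1.trans (mul_le_mul_of_nonneg_left (h η hη) C.2)

/-- The embedding `ι : L(s', s) → L(ℓ²)`, `ι x = j₁ ∘ x ∘ j₂`. -/
def iota (x : SmoothOp) : L2 →L[ℂ] L2 := (j₁.comp x).comp j₂

/-- The unit vector `e_k` in `s'`. -/
def unitSDual (k : ℕ) : SDual := j₂ (lp.single 2 k (1 : ℂ))

theorem unitSDual_apply (k : ℕ) : (unitSDual k : ℕ → ℂ) = Pi.single k (1 : ℂ) := by
  funext i
  exact lp.single_apply (E := fun _ : ℕ => ℂ) 2 k (1 : ℂ) i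

theorem hasSum_unit (t : ℤ) (k : ℕ) :
    HasSum (fun j : ℕ => ‖(unitSDual k : ℕ → ℂ) j‖ ^ 2 * ((j : ℝ) + 1) ^ (2 * t))
      (((k : ℝ) + 1) ^ (2 * t)) := by
  rw [unitSDual_apply]
  convert hasSum_single (f := fun j : ℕ => ‖(Pi.single k (1 : ℂ) : ℕ → ℂ) j‖ ^ 2 *
    ((j : ℝ) + 1) ^ (2 * t)) k (fun j hj => by simp [Pi.single_eq_of_ne hj]) using 1
  simp

theorem wNorm_unit (t : ℤ) (k : ℕ) : wNorm t (unitSDual k) = ((k : ℝ) + 1) ^ t := by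
  rw [wNorm, (hasSum_unit t k).tsum_eq]
  have h2 : ((k : ℝ) + 1) ^ (2 * t) = (((k : ℝ) + 1) ^ t) ^ 2 := by
    rw [mul_comm, zpow_mul]; norm_cast
  rw [h2, Real.sqrt_sq (by positivity)]

/-- The coordinates `⟨η, x e_j⟩` of `x* η` are rapidly decreasing, with bounds that are uniform on
the unit ball of each step of `s'`. -/
theorem adjoint_bounds (x : SmoothOp) (q r : ℕ) : ∃ C : ℝ, ∀ η : SDual, SqSummable (-r) η →
    SqSummable q (fun j => pairing η (x (unitSDual j))) ∧
      wNorm q (fun j => pairing η (x (unitSDual j))) ≤ C * wNorm (-r) η := by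
  obtain ⟨C, hC, h⟩ := exists_bound x r (q + 1)
  have hs : Summable fun j : ℕ => 1 / ((j : ℝ) + 1) ^ 2 := by
    have := (summable_nat_add_iff 1).2 (Real.summable_one_div_nat_pow.2 (by norm_num : 1 < 2))
    simpa using this
  have hb : ∀ η : SDual, SqSummable (-r) η → ∀ j : ℕ,
      ‖pairing η (x (unitSDual j))‖ ^ 2 * ((j : ℝ) + 1) ^ (2 * (q : ℤ)) ≤
        (C * wNorm (-r) η) ^ 2 * (1 / ((j : ℝ) + 1) ^ 2) := by
    intro η hη j
    have hj : (0 : ℝ) < (j : ℝ) + 1 := by positivity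
    have h1 := norm_pairing_le hη ((x (unitSDual j)).2 r)
    have h2 := h (unitSDual j) (hasSum_unit _ j).summable
    rw [wNorm_unit] at h2
    have h3 : ‖pairing η (x (unitSDual j))‖ ≤
        (C * wNorm (-r) η) * ((j : ℝ) + 1) ^ (-((q + 1 : ℕ) : ℤ)) := by
      refine h1.trans ((mul_le_mul_of_nonneg_left h2 (wNorm_nonneg _ _)).trans (le_of_eq ?_))
      ring
    have h4 : ‖pairing η (x (unitSDual j))‖ ^ 2 ≤
        ((C * wNorm (-r) η) * ((j : ℝ) + 1) ^ (-((q + 1 : ℕ) : ℤ))) ^ 2 :=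
      pow_le_pow_left₀ (norm_nonneg _) h3 2
    refine (mul_le_mul_of_nonneg_right h4 (by positivity)).trans (le_of_eq ?_)
    rw [mul_pow, mul_assoc]
    congr 1
    rw [← zpow_natCast, ← zpow_mul, ← zpow_add₀ hj.ne', one_div, ← zpow_natCast, ← zpow_neg]
    congr 1
    push_cast
    ring
  refine ⟨C * √(∑' j : ℕ, 1 / ((j : ℝ) + 1) ^ 2), fun η hη => ?_⟩
  have hsum : SqSummable q (fun j => pairing η (x (unitSDual j))) :=
    Summable.of_nonneg_of_le (fun j => by positivity) (hb η hη) (hs.mul_left _)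
  refine ⟨hsum, ?_⟩
  have h5 := Real.sqrt_le_sqrt (Summable.tsum_le_tsum (hb η hη) hsum (hs.mul_left _))
  rw [tsum_mul_left, Real.sqrt_mul (by positivity),
    Real.sqrt_sq (mul_nonneg hC (wNorm_nonneg _ _))] at h5
  refine le_trans h5 (le_of_eq ?_)
  ring

theorem pairing_add_left (η θ : SDual) (ξ : SSpace) :
    pairing (η + θ : SDual) ξ = pairing η ξ + pairing θ ξ := by
  obtain ⟨q, hq⟩ := η.2
  obtain ⟨r, hr⟩ := θ.2
  rw [pairing, pairing, pairing, ← Summable.tsum_add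
    (summable_pairing hq (ξ.2 q)) (summable_pairing hr (ξ.2 r))]
  exact tsum_congr fun i => add_mul _ _ _

theorem pairing_smul_left (c : ℂ) (η ξ : ℕ → ℂ) : pairing (c • η) ξ = c * pairing η ξ := by
  rw [pairing, pairing, ← tsum_mul_left]
  exact tsum_congr fun i => mul_assoc _ _ _

/-- The adjoint of a smooth operator, `(x* η)_j = ⟨η, x e_j⟩`, as a linear map. -/
def adjointLin (x : SmoothOp) : SDual →ₗ[ℂ] SSpace where
  toFun η := ⟨fun j => pairing η (x (unitSDual j)), fun q => by
    obtain ⟨r, hr⟩ := η.2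
    obtain ⟨C, hC⟩ := adjoint_bounds x q r
    exact (hC η hr).1⟩
  map_add' η θ := Subtype.ext (funext fun j => pairing_add_left η θ _)
  map_smul' c η := Subtype.ext (funext fun j => pairing_smul_left c η _)

/-- The involution of `L(s', s)`; see `iota_star` for its identification with the Hilbert space
adjoint. -/
instance : Star SmoothOp where
  star x := ⟨adjointLin x, continuous_of_bounds _ fun q r =>
    (adjoint_bounds x q r).imp fun _ h η hη => (h η hη).2⟩

/-- `x y = x ∘ j ∘ y` with `j = j₂ ∘ j₁`. -/
instance : Mul SmoothOp where
  mul x y := x.comp ((j₂.comp j₁).comp y)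

theorem mul_def (x y : SmoothOp) : x * y = x.comp ((j₂.comp j₁).comp y) := rfl

theorem iota_mul (x y : SmoothOp) : iota (x * y) = (iota x).comp (iota y) := rfl

theorem iota_star (x : SmoothOp) : iota (star x) = ContinuousLinearMap.adjoint (iota x) := by
  ext η j
  have h : (ContinuousLinearMap.adjoint (iota x) η : ℕ → ℂ) j =
      inner ℂ (lp.single 2 j (1 : ℂ) : L2) (ContinuousLinearMap.adjoint (iota x) η) := by
    rw [lp.inner_single_left]; simp
  rw [h, ContinuousLinearMap.adjoint_inner_right, lp.inner_eq_tsum]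
  change pairing (j₂ η) (x (unitSDual j)) = _
  exact tsum_congr fun i => rfl

/-- The ring structure: pointwise addition and the product defined above. -/
instance : NonUnitalRing SmoothOp :=
  { (inferInstance : AddCommGroup SmoothOp) with
    mul := fun x y => x * y
    left_distrib := fun x y z => by simp only [mul_def, ContinuousLinearMap.comp_add]
    right_distrib := fun x y z => by simp only [mul_def, ContinuousLinearMap.add_comp]
    zero_mul := fun x => by simp only [mul_def, ContinuousLinearMap.zero_comp]
    mul_zero := fun x => by simp only [mul_def, ContinuousLinearMap.comp_zero]
    mul_assoc := fun _ _ _ => rfl }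

/-! ### Rank one operators, orthonormal sequences -/

/-- The operator `⟨·, f⟩ f`, i.e. `η ↦ ⟨η, f⟩ f`. -/
def rankOne (f : SSpace) : SmoothOp where
  toFun η := pairing η f • f
  map_add' η θ := by
    rw [pairing_add_left, add_smul]
  map_smul' c η := by
    have h : pairing (c • η : SDual) f = c * pairing η f := pairing_smul_left c η f
    rw [h, mul_smul]; rfl
  cont := by
    let g : SDual →ₗ[ℂ] SSpace :=
      { toFun := fun η => pairing η f • f
        map_add' := fun η θ => by rw [pairing_add_left, add_smul]
        map_smul' := fun c η => by
          have h : pairing (c • η : SDual) f = c * pairing η f := pairing_smul_left c η f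
          rw [h, mul_smul]; rfl }
    refine continuous_of_bounds g fun q r => ⟨wNorm r f * wNorm q f, fun η hη => ?_⟩
    have h1 : wNorm q (g η) = ‖pairing η f‖ * wNorm q f := wNorm_smul q (pairing η f) f
    rw [h1]
    refine (mul_le_mul_of_nonneg_right (norm_pairing_le hη (f.2 r)) (wNorm_nonneg _ _)).trans
      (le_of_eq ?_)
    ring

/-- The sequence `(f_k)` in `s` is orthonormal (with respect to the scalar product of `ℓ²`). -/
def IsOrthonormalSeq (f : ℕ → SSpace) : Prop := Orthonormal ℂ fun k => j₁ (f k)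

/-- The operators `∑_{j ∈ N_k} ⟨·, f_j⟩ f_j`. -/
def blockProj (f : ℕ → SSpace) (N : ℕ → Finset ℕ) (k : ℕ) : SmoothOp :=
  ∑ j ∈ N k, rankOne (f j)

/-! ### Subalgebras of `L(s', s)` and their canonical bases -/

/-- `P` is a nonzero minimal projection in `E`: a nonzero self-adjoint idempotent of `E` such that
the only self-adjoint idempotents `Q ≤ P` of `E` are `0` and `P`. -/
structure IsMinimalProjection (E : NonUnitalStarSubalgebra ℂ SmoothOp) (P : SmoothOp) : Prop where
  mem : P ∈ E
  isStarProjection : IsStarProjection P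
  ne_zero : P ≠ 0
  minimal : ∀ Q ∈ E, IsStarProjection Q → Q * P = Q → P * Q = Q → Q = 0 ∨ Q = P

/-- The sequence `P` enumerates, without repetition, all nonzero minimal projections in `E`. -/
structure IsCanonicalBasis (E : NonUnitalStarSubalgebra ℂ SmoothOp) (P : ℕ → SmoothOp) :
    Prop where
  injective : Function.Injective P
  range_eq : Set.range P = {Q | IsMinimalProjection E Q}

/-- The sequence `P` is a Schauder basis of `E`: it lies in `E` and each `x ∈ E` has a unique
expansion `x = ∑ c_k P_k`, convergent in the topology of `L(s', s)`. -/
structure IsSchauderBasis (E : NonUnitalStarSubalgebra ℂ SmoothOp) (P : ℕ → SmoothOp) :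
    Prop where
  mem : ∀ k, P k ∈ E
  expansion : ∀ x ∈ E, ∃! c : ℕ → ℂ,
    Filter.Tendsto (fun n => ∑ k ∈ Finset.range n, c k • P k) Filter.atTop (nhds x)

/-- `E` is an infinite-dimensional closed commutative `*`-subalgebra of `L(s', s)`. -/
structure IsInfDimClosedComm (E : NonUnitalStarSubalgebra ℂ SmoothOp) : Prop where
  infinite_dimensional : ¬ FiniteDimensional ℂ E
  isClosed : IsClosed (E : Set SmoothOp)
  comm : ∀ x ∈ E, ∀ y ∈ E, x * y = y * x

/-! ### Köthe algebras -/

/-- A Köthe matrix `(a_{j,q})`. -/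
structure KotheMatrix where
  entry : ℕ → ℕ → ℝ
  nonneg : ∀ j q, 0 ≤ entry j q
  exists_pos : ∀ j, ∃ q, 0 < entry j q
  mono : ∀ j q, entry j q ≤ entry j (q + 1)

/-- The sequences `ξ` with `sup_j |ξ_j| a_{j,q} < ∞` for all `q`. -/
def kotheSubmodule (A : KotheMatrix) : Submodule ℂ (ℕ → ℂ) where
  carrier := {ξ | ∀ q, BddAbove (Set.range fun j => ‖ξ j‖ * A.entry j q)}
  zero_mem' := fun q => ⟨0, by rintro _ ⟨j, rfl⟩; simp⟩
  add_mem' := by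
    intro ξ η hξ hη q
    obtain ⟨C, hC⟩ := hξ q
    obtain ⟨D, hD⟩ := hη q
    refine ⟨C + D, ?_⟩
    rintro _ ⟨j, rfl⟩
    have h1 := hC ⟨j, rfl⟩
    have h2 := hD ⟨j, rfl⟩
    refine (mul_le_mul_of_nonneg_right (norm_add_le (ξ j) (η j)) (A.nonneg j q)).trans ?_
    rw [add_mul]
    exact add_le_add h1 h2
  smul_mem' := by
    intro c ξ hξ q
    obtain ⟨C, hC⟩ := hξ q
    refine ⟨‖c‖ * C, ?_⟩
    rintro _ ⟨j, rfl⟩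
    have h1 := hC ⟨j, rfl⟩
    simp only [Pi.smul_apply, smul_eq_mul, norm_mul, mul_assoc]
    exact mul_le_mul_of_nonneg_left h1 (norm_nonneg c)

/-- The Köthe space `λ^∞(A)`. -/
def KotheSpace (A : KotheMatrix) : Type := kotheSubmodule A

instance (A : KotheMatrix) : AddCommGroup (KotheSpace A) :=
  inferInstanceAs (AddCommGroup (kotheSubmodule A))
instance (A : KotheMatrix) : Module ℂ (KotheSpace A) :=
  inferInstanceAs (Module ℂ (kotheSubmodule A))
instance (A : KotheMatrix) : CoeFun (KotheSpace A) (fun _ => ℕ → ℂ) := ⟨fun ξ => ξ.1⟩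

/-- The seminorms `|ξ|_{∞,q} = sup_j |ξ_j| a_{j,q}` on `λ^∞(A)`. -/
def kotheSeminorm (A : KotheMatrix) : SeminormFamily ℂ (KotheSpace A) ℕ := fun q =>
  Seminorm.of (fun ξ => ⨆ j, ‖(ξ : ℕ → ℂ) j‖ * A.entry j q)
    (fun ξ η => by
      refine ciSup_le fun j => ?_
      refine (mul_le_mul_of_nonneg_right (norm_add_le (ξ.1 j) (η.1 j)) (A.nonneg j q)).trans ?_
      rw [add_mul]
      exact add_le_add (le_ciSup (ξ.2 q) j) (le_ciSup (η.2 q) j))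
    (fun c ξ => by
      rw [Real.mul_iSup_of_nonneg (norm_nonneg c)]
      refine iSup_congr fun j => ?_
      rw [← mul_assoc, ← norm_mul]
      rfl)

instance (A : KotheMatrix) : TopologicalSpace (KotheSpace A) :=
  (kotheSeminorm A).moduleFilterBasis.topology

theorem withSeminorms_kothe (A : KotheMatrix) : WithSeminorms (kotheSeminorm A) := ⟨rfl⟩

/-- The Köthe space `λ^∞(A)` is closed under coordinatewise multiplication. -/
class KotheMatrix.IsAlgebra (A : KotheMatrix) : Prop where
  mul_mem : ∀ ξ ∈ kotheSubmodule A, ∀ η ∈ kotheSubmodule A, ξ * η ∈ kotheSubmodule A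

/-- This is the case for matrices with entries `≥ 1`. -/
theorem KotheMatrix.isAlgebra_of_one_le (A : KotheMatrix) (h : ∀ j q, 1 ≤ A.entry j q) :
    A.IsAlgebra where
  mul_mem := by
    intro ξ hξ η hη q
    obtain ⟨C, hC⟩ := hξ q
    obtain ⟨D, hD⟩ := hη q
    refine ⟨C * D, ?_⟩
    rintro _ ⟨j, rfl⟩
    have h1 : ‖ξ j‖ * A.entry j q ≤ C := hC ⟨j, rfl⟩
    have h2 : ‖η j‖ * A.entry j q ≤ D := hD ⟨j, rfl⟩
    have h3 : ‖ξ j‖ ≤ C := (le_mul_of_one_le_right (norm_nonneg _) (h j q)).trans h1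
    simp only [Pi.mul_apply, norm_mul, mul_assoc]
    exact mul_le_mul h3 h2 (mul_nonneg (norm_nonneg _) (A.nonneg j q))
      ((norm_nonneg _).trans h3)

/-- Coordinatewise multiplication on a Köthe algebra. -/
instance (A : KotheMatrix) [A.IsAlgebra] : Mul (KotheSpace A) where
  mul ξ η := ⟨ξ.1 * η.1, KotheMatrix.IsAlgebra.mul_mem ξ.1 ξ.2 η.1 η.2⟩

/-- Coordinatewise complex conjugation. -/
instance (A : KotheMatrix) : Star (KotheSpace A) where
  star ξ := ⟨fun j => conj (ξ.1 j), fun q => by simpa using ξ.2 q⟩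

/-- The unit vector `e_k` in `λ^∞(A)`. -/
def kotheUnit (A : KotheMatrix) (k : ℕ) : KotheSpace A :=
  ⟨Pi.single k 1, fun q => ⟨A.entry k q, by
    rintro _ ⟨j, rfl⟩
    rcases eq_or_ne j k with rfl | hj
    · simp
    · simpa [Pi.single_eq_of_ne hj] using A.nonneg k q⟩⟩

theorem one_le_sNorm {f : ℕ → SSpace} (hf : IsOrthonormalSeq f) (j q : ℕ) :
    1 ≤ sNorm q (f j) := by
  have h1 : wNorm 0 (f j) = 1 := (wNorm_L2 (j₁ (f j))).trans (hf.1 j)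
  have h2 : wNorm 0 (f j) ≤ wNorm q (f j) := wNorm_mono (by positivity) ((f j).2 q)
  rw [h1] at h2
  exact h2

theorem sNorm_mono (ξ : SSpace) (q : ℕ) : sNorm q ξ ≤ sNorm (q + 1) ξ :=
  wNorm_mono (by push_cast; omega) (ξ.2 (q + 1))

theorem one_le_max {f : ℕ → SSpace} (hf : IsOrthonormalSeq f) {N : ℕ → Finset ℕ}
    (hN : ∀ k, (N k).Nonempty) (k q : ℕ) : 1 ≤ (N k).sup' (hN k) fun j => sNorm q (f j) := by
  obtain ⟨j, hj⟩ := hN k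
  exact (one_le_sNorm hf j q).trans (Finset.le_sup' (fun j => sNorm q (f j)) hj)

/-- The Köthe matrix `(max_{j ∈ N_k} |f_j|_q)_{k,q}`. -/
def maxMatrix (f : ℕ → SSpace) (hf : IsOrthonormalSeq f) (N : ℕ → Finset ℕ)
    (hN : ∀ k, (N k).Nonempty) : KotheMatrix where
  entry k q := (N k).sup' (hN k) fun j => sNorm q (f j)
  nonneg k q := zero_le_one.trans (one_le_max hf hN k q)
  exists_pos k := ⟨0, zero_lt_one.trans_le (one_le_max hf hN k 0)⟩
  mono _ q := Finset.sup'_mono_fun fun j _ => sNorm_mono (f j) q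

instance (f : ℕ → SSpace) (hf : IsOrthonormalSeq f) (N : ℕ → Finset ℕ)
    (hN : ∀ k, (N k).Nonempty) : (maxMatrix f hf N hN).IsAlgebra :=
  KotheMatrix.isAlgebra_of_one_le _ fun k q => one_le_max hf hN k q

/-- There is an isomorphism of Fréchet `*`-algebras `E ≅ λ^∞(A)`, i.e. a bijective
`*`-homomorphism that is a homeomorphism, which sends `P_k` to `e_k` for all `k`. -/
def IsoVia (E : NonUnitalStarSubalgebra ℂ SmoothOp) (P : ℕ → SmoothOp) (A : KotheMatrix)
    [A.IsAlgebra] : Prop :=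
  ∃ Φ : E ≃⋆ₐ[ℂ] KotheSpace A, IsHomeomorph Φ ∧
    ∀ k, ∃ h : P k ∈ E, Φ ⟨P k, h⟩ = kotheUnit A k

end SmoothOperators

end

open scoped ComplexConjugate

noncomputable section

namespace SmoothOperators

open Filter Topology

section

/-! ### Weighted operators on `ℓ²` and the topology of `L(s', s)` -/

/-! Let `D` be multiplication by `j + 1`. Bounded subsets of `s'` are bounded in a single step, so
the topology of `L(s', s)` is given by the norms `‖x‖_q = ‖D^q x D^q‖` on `ℓ²`
(`isInducing_weightedOp`), and the space is sequentially complete.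

Two estimates identify block diagonal operators with a Köthe algebra. If `x f_j = c_k f_j` for `j ∈
N_k`, applying `x` to `f_j` gives `|c_k| max |f_j|_q ≤ ‖x‖_q` (`norm_mul_entry_le`). Conversely a
unit vector satisfies `|f|_q² ≤ |f|_{4q+4} |f|'_1²`, and `∑ |f_j|'_1² ≤ ∑ (i+1)^{-2}` by Bessel;
hence `∑ c_k P_k` converges absolutely, with `‖·‖_q` bounded by a constant times `sup |c_k| max
|f_j|_{4q+4}` (`exists_hasSum_blockProj`). The blocks may be arbitrarily large, because their sizes
enter neither estimate.

What remains is spectral theory inside `E`. Smooth operators are compact on `ℓ²`. For self-adjoint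
`y ∈ E` the powers of `y²/‖y‖²` converge in operator norm to a spectral projection. Sandwiching them
between smooth operators turns this into convergence in `L(s', s)`, so the projection lies in the
closed algebra `E` (`exists_spectralProjection`). Projections have finite rank, so minimal ones lie
below every nonzero one. Each element of `E` is scalar on a minimal projection, and an element
killed by all of them vanishes; thus `x = ∑ c_k P_k`.

The ranges of the minimal projections are mutually orthogonal, and orthonormal bases of them lie in
`s` and together give `(f_j)` and `(N_k)`. For the converse, the sums `∑ c_k P_k` form the required
algebra, closed by the same two estimates. -/

theorem weighted_weighted (t u : ℤ) (ξ : ℕ → ℂ) :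
    weighted t (weighted u ξ) = weighted (t + u) ξ := by
  funext j
  have h : ((j : ℝ) + 1) ≠ 0 := by positivity
  simp only [weighted, zpow_add₀ h]
  push_cast
  ring

theorem weighted_zero_exponent (ξ : ℕ → ℂ) : weighted 0 ξ = ξ := by
  funext j; simp [weighted]

theorem sqSummable_neg_weighted (q : ℤ) (ξ : L2) : SqSummable (-q) (weighted q ξ) := by
  rw [sqSummable_iff, weighted_weighted, neg_add_cancel, weighted_zero_exponent]
  exact ξ.2

theorem wNorm_neg_weighted (q : ℤ) (ξ : L2) : wNorm (-q) (weighted q ξ) = ‖ξ‖ := by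
  rw [wNorm_eq_norm _ _ (sqSummable_neg_weighted q ξ)]
  congr 1
  refine Subtype.ext ?_
  change weighted (-q) (weighted q ξ) = ξ
  rw [weighted_weighted, neg_add_cancel, weighted_zero_exponent]

/-- The map `ξ ↦ (j ^ q ξ_j)_j` from `s` to `ℓ²`, as a linear map. -/
def toWeightedLin (q : ℕ) : SSpace →ₗ[ℂ] L2 where
  toFun ξ := weightedL2 q ξ (ξ.2 q)
  map_add' ξ η := Subtype.ext (weighted_add q ξ η)
  map_smul' c ξ := Subtype.ext (weighted_smul q c ξ)

theorem norm_toWeightedLin (q : ℕ) (ξ : SSpace) : ‖toWeightedLin q ξ‖ = sNorm q ξ :=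
  (wNorm_eq_norm _ _ (ξ.2 q)).symm

/-- The map `ξ ↦ (j ^ q ξ_j)_j` from `s` to `ℓ²`. -/
def toWeighted (q : ℕ) : SSpace →L[ℂ] L2 where
  toLinearMap := toWeightedLin q
  cont := WithSeminorms.continuous_normedSpace_rng (p := sNorm) L2 withSeminorms_sNorm _
    ⟨{q}, 1, fun ξ => by simpa using (norm_toWeightedLin q ξ).le⟩

theorem norm_toWeighted (q : ℕ) (ξ : SSpace) : ‖toWeighted q ξ‖ = sNorm q ξ :=
  norm_toWeightedLin q ξ

/-- The map `ξ ↦ (j ^ q ξ_j)_j` from `ℓ²` to `s'`, as a linear map. -/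
def ofWeightedLin (q : ℕ) : L2 →ₗ[ℂ] SDual where
  toFun ξ := ⟨weighted q ξ, q, sqSummable_neg_weighted q ξ⟩
  map_add' ξ η := Subtype.ext (weighted_add q ξ η)
  map_smul' c ξ := Subtype.ext (weighted_smul q c ξ)

/-- The map `ξ ↦ (j ^ q ξ_j)_j` from `ℓ²` to `s'`. -/
def ofWeighted (q : ℕ) : L2 →L[ℂ] SDual where
  toLinearMap := ofWeightedLin q
  cont := by
    refine WithSeminorms.continuous_normedSpace_dom (q := sDualSeminorms) L2 withSeminorms_sDual _
      fun p => ?_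
    obtain ⟨C, hC⟩ := p.2 q
    refine ⟨⟨max C 0, le_max_right _ _⟩, fun ξ => ?_⟩
    have h := hC (ofWeightedLin q ξ) (sqSummable_neg_weighted q ξ)
    have h2 : wNorm (-q) (ofWeightedLin q ξ) = ‖ξ‖ := wNorm_neg_weighted q ξ
    rw [h2] at h
    exact h.trans (mul_le_mul_of_nonneg_right (le_max_left _ _) (norm_nonneg _))

theorem ofWeighted_weightedL2 (q : ℕ) (η : SDual) (h : SqSummable (-q) η) :
    ofWeighted q (weightedL2 (-q) η h) = η := by
  refine Subtype.ext ?_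
  change weighted q (weighted (-q) η) = η
  rw [weighted_weighted, add_neg_cancel, weighted_zero_exponent]

theorem weightedL2_ofWeighted (q : ℕ) (ξ : L2) (h : SqSummable (-q) (ofWeighted q ξ)) :
    weightedL2 (-q) (ofWeighted q ξ) h = ξ := by
  refine Subtype.ext ?_
  change weighted (-q) (weighted q ξ) = ξ
  rw [weighted_weighted, neg_add_cancel, weighted_zero_exponent]

theorem toWeighted_injective (q : ℕ) : Function.Injective (toWeighted q) := by
  intro ξ η h
  refine Subtype.ext ?_
  have h1 : weighted q ξ = weighted q η := congrArg Subtype.val h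
  have h2 := congrArg (weighted (-q)) h1
  rwa [weighted_weighted, weighted_weighted, neg_add_cancel, weighted_zero_exponent,
    weighted_zero_exponent] at h2

theorem j₁_injective : Function.Injective j₁ := by
  intro ξ η h
  have h1 : (j₁ ξ : ℕ → ℂ) = j₁ η := congrArg (fun ζ : L2 => (ζ : ℕ → ℂ)) h
  exact Subtype.ext h1

instance : T2Space SSpace := T2Space.of_injective_continuous j₁_injective j₁.continuous

/-- The operator `ξ ↦ (j ^ q (x (i ^ q ξ_i)_i)_j)_j` on `ℓ²`. -/
def weightedOp (q : ℕ) : SmoothOp →L[ℂ] (L2 →L[ℂ] L2) :=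
  (ContinuousLinearMap.postcomp L2 (toWeighted q)).comp
    (ContinuousLinearMap.precomp SSpace (ofWeighted q))

theorem weightedOp_apply (q : ℕ) (x : SmoothOp) (ξ : L2) :
    weightedOp q x ξ = toWeighted q (x (ofWeighted q ξ)) := rfl

theorem weightedOp_zero (x : SmoothOp) : weightedOp 0 x = iota x := by
  ext1 ξ
  have h1 : ofWeighted 0 ξ = j₂ ξ := Subtype.ext (weighted_zero_exponent _)
  have h2 : ∀ η, toWeighted 0 η = j₁ η := fun η => Subtype.ext (weighted_zero_exponent _)
  rw [weightedOp_apply, h1, h2]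
  rfl

theorem wNorm_apply_le (q : ℕ) (x : SmoothOp) (η : SDual) (h : SqSummable (-q) η) :
    sNorm q (x η) ≤ ‖weightedOp q x‖ * wNorm (-q) η := by
  have h1 := (weightedOp q x).le_opNorm (weightedL2 (-q) η h)
  rwa [weightedOp_apply, ofWeighted_weightedL2, norm_toWeighted, ← wNorm_eq_norm] at h1

theorem norm_apply_le_wNorm {q : ℕ} {η : ℕ → ℂ} (h : SqSummable (-q) η) (j : ℕ) :
    ‖η j‖ ≤ wNorm (-q) η * ((j : ℝ) + 1) ^ q := by
  have h1 := lp.norm_apply_le_norm (by norm_num) (weightedL2 (-q) η h) j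
  rw [← wNorm_eq_norm] at h1
  have hj : (0 : ℝ) < ((j : ℝ) + 1) ^ q := by positivity
  have h2 : ‖(weightedL2 (-q) η h : ℕ → ℂ) j‖ = (((j : ℝ) + 1) ^ q)⁻¹ * ‖η j‖ := by
    change ‖weighted (-q) η j‖ = _
    rw [weighted, norm_mul, Complex.norm_real, Real.norm_of_nonneg (by positivity), zpow_neg,
      zpow_natCast]
  rw [h2, inv_mul_le_iff₀ hj] at h1
  linarith

theorem summable_inv_sq : Summable fun j : ℕ => 1 / ((j : ℝ) + 1) ^ 2 := by
  have := (summable_nat_add_iff 1).2 (Real.summable_one_div_nat_pow.2 (by norm_num : 1 < 2))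
  simpa using this

/-- The inductive limit `s'` is regular: each bounded set is bounded in one of the steps. -/
theorem exists_step_of_isVonNBounded {S : Set SDual} (hS : Bornology.IsVonNBounded ℂ S) :
    ∃ (q : ℕ) (C : ℝ), 0 < C ∧ ∀ η ∈ S, SqSummable (-q) η ∧ wNorm (-q) η ≤ C := by
  have key : ∃ n : ℕ, ∀ η ∈ S, ∀ j : ℕ, ‖η j‖ ≤ n * ((j : ℝ) + 1) ^ n := by
    -- Otherwise there are `η n ∈ S` and positions `j n` with `‖η n (j n)‖ > n (j n + 1)^n`. The
    -- seminorm `p θ = sup_n ‖θ (j n)‖ / (j n + 1)^n` is then unbounded on `S`. It is nevertheless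
    -- continuous on the step `r`: for `n ≥ r` the denominator dominates `(j n + 1)^r`, and the
    -- finitely many `n < r` are absorbed by the sum in the constant.
    by_contra! hcon
    choose η hη j hj using hcon
    have hb : ∀ (r : ℕ) (θ : SDual), SqSummable (-r) θ → ∀ n,
        ‖θ (j n)‖ / ((j n : ℝ) + 1) ^ n ≤
          (∑ m ∈ Finset.range r, ((j m : ℝ) + 1) ^ r + 1) * wNorm (-r) θ := by
      intro r θ hθ n
      have hpos : (0 : ℝ) < ((j n : ℝ) + 1) ^ n := by positivity
      have hone : (1 : ℝ) ≤ (j n : ℝ) + 1 := by simp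
      have hw := wNorm_nonneg (-r) θ
      have hsum : 0 ≤ ∑ m ∈ Finset.range r, ((j m : ℝ) + 1) ^ r :=
        Finset.sum_nonneg fun _ _ => by positivity
      have h1 := norm_apply_le_wNorm hθ (j n)
      rw [div_le_iff₀ hpos]
      rcases lt_or_ge n r with hn | hn
      · have h2 : ((j n : ℝ) + 1) ^ r ≤ ∑ m ∈ Finset.range r, ((j m : ℝ) + 1) ^ r :=
          Finset.single_le_sum (f := fun m => ((j m : ℝ) + 1) ^ r) (fun _ _ => by positivity)
            (Finset.mem_range.2 hn)
        have h3 : (1 : ℝ) ≤ ((j n : ℝ) + 1) ^ n := one_le_pow₀ hone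
        calc ‖θ (j n)‖ ≤ wNorm (-r) θ * ((j n : ℝ) + 1) ^ r := h1
          _ ≤ wNorm (-r) θ * (∑ m ∈ Finset.range r, ((j m : ℝ) + 1) ^ r + 1) := by
            gcongr; linarith
          _ = (∑ m ∈ Finset.range r, ((j m : ℝ) + 1) ^ r + 1) * wNorm (-r) θ * 1 := by ring
          _ ≤ _ := by gcongr
      · have h2 : ((j n : ℝ) + 1) ^ r ≤ ((j n : ℝ) + 1) ^ n := pow_le_pow_right₀ hone hn
        calc ‖θ (j n)‖ ≤ wNorm (-r) θ * ((j n : ℝ) + 1) ^ r := h1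
          _ ≤ wNorm (-r) θ * ((j n : ℝ) + 1) ^ n := by gcongr
          _ = 1 * wNorm (-r) θ * ((j n : ℝ) + 1) ^ n := by ring
          _ ≤ _ := by gcongr; linarith
    have hbdd : ∀ θ : SDual, BddAbove (Set.range fun n => ‖θ (j n)‖ / ((j n : ℝ) + 1) ^ n) := by
      intro θ
      obtain ⟨r, hr⟩ := θ.2
      exact ⟨_, by rintro _ ⟨n, rfl⟩; exact hb r θ hr n⟩
    let p : Seminorm ℂ SDual := Seminorm.of (fun θ => ⨆ n, ‖θ (j n)‖ / ((j n : ℝ) + 1) ^ n)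
      (fun θ ζ => by
        refine ciSup_le fun n => ?_
        refine (div_le_div_of_nonneg_right (norm_add_le (θ.1 (j n)) (ζ.1 (j n)))
          (by positivity)).trans ?_
        rw [add_div]
        exact add_le_add (le_ciSup (hbdd θ) n) (le_ciSup (hbdd ζ) n))
      (fun c θ => by
        rw [Real.mul_iSup_of_nonneg (norm_nonneg c)]
        refine iSup_congr fun n => ?_
        rw [← mul_div_assoc, ← norm_mul]
        rfl)
    have hp : ∀ r : ℕ, ∃ C : ℝ, ∀ θ : SDual, SqSummable (-r) θ → p θ ≤ C * wNorm (-r) θ :=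
      fun r => ⟨_, fun θ hθ => ciSup_le fun n => hb r θ hθ n⟩
    obtain ⟨R, -, hR⟩ := withSeminorms_sDual.isVonNBounded_iff_seminorm_bounded.1 hS
      (⟨p, hp⟩ : StepContinuousSeminorm)
    obtain ⟨n, hn⟩ := exists_nat_gt R
    have h1 : p (η n) < R := hR _ (hη n)
    have h2 : ‖(η n) (j n)‖ / ((j n : ℝ) + 1) ^ n ≤ p (η n) := le_ciSup (hbdd (η n)) n
    have h3 : (n : ℝ) < ‖(η n) (j n)‖ / ((j n : ℝ) + 1) ^ n := by
      rw [lt_div_iff₀ (by positivity)]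
      exact hj n
    linarith
  obtain ⟨n, hn⟩ := key
  have hs := summable_inv_sq
  have hle : ∀ η ∈ S, ∀ j : ℕ, ‖η j‖ ^ 2 * ((j : ℝ) + 1) ^ (2 * (-((n + 1 : ℕ) : ℤ))) ≤
      (n : ℝ) ^ 2 * (1 / ((j : ℝ) + 1) ^ 2) := by
    intro η hη j
    have hj : (0 : ℝ) < (j : ℝ) + 1 := by positivity
    have h1 : ‖η j‖ ^ 2 ≤ (n * ((j : ℝ) + 1) ^ n) ^ 2 :=
      pow_le_pow_left₀ (norm_nonneg _) (hn η hη j) 2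
    have h2 : ((j : ℝ) + 1) ^ (2 * (-((n + 1 : ℕ) : ℤ))) =
        ((((j : ℝ) + 1) ^ n) ^ 2 * ((j : ℝ) + 1) ^ 2)⁻¹ := by
      rw [← pow_mul, ← pow_add, ← zpow_natCast, ← zpow_neg]
      congr 1
      push_cast
      ring
    rw [h2, ← div_eq_mul_inv, div_le_iff₀ (by positivity)]
    refine h1.trans (le_of_eq ?_)
    field_simp
  -- One extra power of the weight turns the pointwise bound into a square summable one; the added
  -- `1` only makes the constant positive.
  refine ⟨n + 1, √(∑' j : ℕ, (n : ℝ) ^ 2 * (1 / ((j : ℝ) + 1) ^ 2)) + 1, by positivity,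
    fun η hη => ?_⟩
  have h1 : SqSummable (-((n + 1 : ℕ) : ℤ)) η :=
    Summable.of_nonneg_of_le (fun j => by positivity) (hle η hη) (hs.mul_left _)
  refine ⟨h1, ?_⟩
  have h2 : wNorm (-((n + 1 : ℕ) : ℤ)) η ≤ √(∑' j : ℕ, (n : ℝ) ^ 2 * (1 / ((j : ℝ) + 1) ^ 2)) :=
    Real.sqrt_le_sqrt (Summable.tsum_le_tsum (hle η hη) h1 (hs.mul_left _))
  linarith

/-- The topology of `L(s', s)` is generated by the norms of the weighted operators. -/
theorem isInducing_weightedOp :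
    IsInducing (ContinuousLinearMap.pi weightedOp : SmoothOp →L[ℂ] (ℕ → L2 →L[ℂ] L2)) := by
  rw [IsTopologicalAddGroup.isInducing_iff_nhds_zero]
  refine le_antisymm ?_ ?_
  · have := (ContinuousLinearMap.pi weightedOp : SmoothOp →L[ℂ] (ℕ → L2 →L[ℂ] L2)).continuous.tendsto
      0
    rw [map_zero] at this
    exact this.le_comap
  · refine (ContinuousLinearMap.hasBasis_nhds_zero (𝕜₁ := ℂ) (E := SDual) (F := SSpace)).ge_iff.2 ?_
    rintro ⟨S, U⟩ ⟨hS, hU⟩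
    obtain ⟨q, C, hC, hq⟩ := exists_step_of_isVonNBounded hS
    obtain ⟨s, ε, hε, hs⟩ := (withSeminorms_sNorm.mem_nhds_iff 0 U).1 hU
    -- Raising the index weakens the norms `|·|'` and strengthens the norms `|·|`, so one `r` serves
    -- both the step containing `S` and the finitely many seminorms defining `U`.
    set r := max q (s.sup id) with hr
    have hmem : {T : ℕ → L2 →L[ℂ] L2 | ‖T r‖ < ε / C} ∈ 𝓝 (0 : ℕ → L2 →L[ℂ] L2) := by
      refine (isOpen_lt (by fun_prop) continuous_const).mem_nhds ?_
      simp only [Set.mem_ofPred_eq, Pi.zero_apply, norm_zero]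
      positivity
    refine mem_comap.2 ⟨_, hmem, fun x hx η hη => hs ?_⟩
    have hx' : ‖weightedOp r x‖ < ε / C := hx
    rw [Seminorm.mem_ball, sub_zero]
    refine Seminorm.finset_sup_apply_lt hε fun i hi => ?_
    have hqr : -(r : ℤ) ≤ -(q : ℤ) := by
      have : q ≤ r := le_max_left _ _
      omega
    have hir : i ≤ r := (Finset.le_sup (f := id) hi).trans (le_max_right _ _)
    obtain ⟨h1, h2⟩ := hq η hη
    have h3 := wNorm_apply_le r x η (h1.mono hqr)
    have h4 : wNorm (-r) η ≤ C := (wNorm_mono hqr h1).trans h2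
    have h5 : sNorm i (x η) ≤ sNorm r (x η) := wNorm_mono (by exact_mod_cast hir) ((x η).2 r)
    calc sNorm i (x η) ≤ ‖weightedOp r x‖ * wNorm (-r) η := h5.trans h3
      _ ≤ ‖weightedOp r x‖ * C := by gcongr
      _ < ε / C * C := by gcongr
      _ = ε := by field_simp

theorem tendsto_smoothOp_iff {α : Type*} {l : Filter α} {x : α → SmoothOp} {y : SmoothOp} :
    Tendsto x l (𝓝 y) ↔ ∀ q, Tendsto (fun a => weightedOp q (x a)) l (𝓝 (weightedOp q y)) := by
  rw [isInducing_weightedOp.tendsto_nhds_iff, tendsto_pi_nhds]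
  rfl

theorem continuous_smoothOp_iff {α : Type*} [TopologicalSpace α] {x : α → SmoothOp} :
    Continuous x ↔ ∀ q, Continuous fun a => weightedOp q (x a) := by
  rw [isInducing_weightedOp.continuous_iff, continuous_pi_iff]
  rfl

/-- The space `L(s', s)` is sequentially complete. -/
theorem exists_tendsto_of_weightedOp {x : ℕ → SmoothOp} {T : ℕ → L2 →L[ℂ] L2}
    (h : ∀ q, Tendsto (fun n => weightedOp q (x n)) atTop (𝓝 (T q))) :
    ∃ y : SmoothOp, Tendsto x atTop (𝓝 y) ∧ ∀ q, weightedOp q y = T q := by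
  have hstep : ∀ (η : SDual) (q : ℕ) (hq : SqSummable (-q) η), Tendsto
      (fun n => toWeighted q (x n η)) atTop (𝓝 (T q (weightedL2 (-q) η hq))) := by
    intro η q hq
    have h1 := ((ContinuousLinearMap.apply ℂ L2 (weightedL2 (-q) η hq)).continuous.tendsto
      (T q)).comp (h q)
    refine h1.congr fun n => ?_
    change weightedOp q (x n) (weightedL2 (-q) η hq) = _
    rw [weightedOp_apply, ofWeighted_weightedL2]
  have hcoord : ∀ (η : SDual) (q : ℕ) (hq : SqSummable (-q) η) (i : ℕ), Tendsto
      (fun n => (x n η : ℕ → ℂ) i) atTop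
        (𝓝 (weighted (-q) (T q (weightedL2 (-q) η hq)) i)) := by
    intro η q hq i
    have h1 : Tendsto (fun n => (toWeighted q (x n η) : ℕ → ℂ) i) atTop
        (𝓝 ((T q (weightedL2 (-q) η hq) : ℕ → ℂ) i)) :=
      ((lp.evalCLM ℂ (fun _ : ℕ => ℂ) 2 i).continuous.tendsto _).comp (hstep η q hq)
    have h2 := h1.const_mul ((((((i : ℝ) + 1) ^ (-q : ℤ) : ℝ)) : ℂ))
    refine h2.congr fun n => ?_
    change weighted (-q) (weighted q (x n η)) i = _
    rw [weighted_weighted, neg_add_cancel, weighted_zero_exponent]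
  have hex : ∀ η : SDual, ∃ ζ : SSpace, ∀ i, Tendsto (fun n => (x n η : ℕ → ℂ) i) atTop
      (𝓝 ((ζ : ℕ → ℂ) i)) := by
    intro η
    obtain ⟨r, hr⟩ := η.2
    have hlim := fun q (hq : r ≤ q) => hcoord η q (hr.mono (by omega))
    refine ⟨⟨weighted (-r) (T r (weightedL2 (-r) η hr)), fun q => ?_⟩, hcoord η r hr⟩
    -- For every exponent `≥ r` the limit operator yields the same coordinates, namely the limits of
    -- those of `x n η`. Hence one sequence has finite norm for all `q`.
    have heq : weighted (-r) (T r (weightedL2 (-r) η hr)) =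
        weighted (-(max q r : ℕ)) (T (max q r) (weightedL2 (-(max q r : ℕ)) η
          (hr.mono (by push_cast; omega)))) :=
      funext fun i => tendsto_nhds_unique (hcoord η r hr i) (hlim _ (le_max_right q r) i)
    rw [heq]
    refine SqSummable.mono (u := (max q r : ℕ)) (by push_cast; omega) ?_
    rw [sqSummable_iff, weighted_weighted, add_neg_cancel, weighted_zero_exponent]
    exact (T _ _).2
  choose g hg using hex
  have huniq : ∀ {η : SDual} {ζ : SSpace}, (∀ i, Tendsto (fun n => (x n η : ℕ → ℂ) i) atTop
      (𝓝 ((ζ : ℕ → ℂ) i))) → g η = ζ := fun hζ =>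
    Subtype.ext (funext fun i => tendsto_nhds_unique (hg _ i) (hζ i))
  let G : SDual →ₗ[ℂ] SSpace :=
    { toFun := g
      map_add' := fun η θ => huniq fun i => by
        refine ((hg η i).add (hg θ i)).congr fun n => ?_
        rw [map_add]; rfl
      map_smul' := fun c η => huniq fun i => by
        refine ((hg η i).const_mul c).congr fun n => ?_
        rw [map_smul]; rfl }
  have hG : ∀ (η : SDual) (q : ℕ) (hq : SqSummable (-q) η),
      toWeighted q (G η) = T q (weightedL2 (-q) η hq) := by
    intro η q hq
    have h1 : (G η : ℕ → ℂ) = weighted (-q) (T q (weightedL2 (-q) η hq)) :=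
      funext fun i => tendsto_nhds_unique (hg _ i) (hcoord η q hq i)
    refine Subtype.ext ?_
    change weighted q (G η) = _
    rw [h1, weighted_weighted, add_neg_cancel, weighted_zero_exponent]
  have hcont : Continuous G := by
    refine continuous_of_bounds G fun q r => ⟨‖T (max q r)‖, fun η hη => ?_⟩
    have hmr : -((max q r : ℕ) : ℤ) ≤ -(r : ℤ) := by push_cast; omega
    have h1 := hG η (max q r) (hη.mono hmr)
    have h2 : sNorm (max q r) (G η) ≤ ‖T (max q r)‖ * wNorm (-(max q r : ℕ)) η := by
      rw [← norm_toWeighted, h1, wNorm_eq_norm _ _ (hη.mono hmr)]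
      exact (T _).le_opNorm _
    have h3 : wNorm q (G η) ≤ sNorm (max q r) (G η) :=
      wNorm_mono (by push_cast; omega) ((G η).2 _)
    exact h3.trans (h2.trans (mul_le_mul_of_nonneg_left (wNorm_mono hmr hη) (norm_nonneg _)))
  let y : SmoothOp := ⟨G, hcont⟩
  have hy : ∀ q, weightedOp q y = T q := by
    intro q
    ext1 ξ
    have h1 : toWeighted q (y (ofWeighted q ξ)) =
        T q (weightedL2 (-q) (ofWeighted q ξ) (sqSummable_neg_weighted q ξ)) :=
      hG (ofWeighted q ξ) q (sqSummable_neg_weighted q ξ)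
    exact h1.trans (congrArg (T q) (weightedL2_ofWeighted q ξ _))
  refine ⟨y, tendsto_smoothOp_iff.2 fun q => ?_, hy⟩
  rw [hy q]
  exact h q

end

section

/-! ### The embedding into `L(ℓ²)` and rank one operators -/

theorem iota_zero : iota 0 = 0 := by rw [← weightedOp_zero, map_zero]

theorem iota_add (x y : SmoothOp) : iota (x + y) = iota x + iota y := by
  simp only [← weightedOp_zero, map_add]

theorem iota_smul (c : ℂ) (x : SmoothOp) : iota (c • x) = c • iota x := by
  simp only [← weightedOp_zero, map_smul]

theorem continuous_iota : Continuous iota := by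
  have : iota = weightedOp 0 := funext fun x => (weightedOp_zero x).symm
  rw [this]
  exact (weightedOp 0).continuous

theorem ext_of_single {T U : L2 →L[ℂ] L2}
    (h : ∀ i, T (lp.single 2 i (1 : ℂ)) = U (lp.single 2 i (1 : ℂ))) : T = U := by
  refine lp.ext_continuousLinearMap (by norm_num) fun i => ?_
  ext1
  exact h i

theorem ofWeighted_single (q i : ℕ) :
    ofWeighted q (lp.single 2 i (1 : ℂ)) =
      ((((i : ℝ) + 1) ^ q : ℝ) : ℂ) • j₂ (lp.single 2 i (1 : ℂ)) := by
  refine Subtype.ext (funext fun l => ?_)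
  change weighted q _ l = ((((i : ℝ) + 1) ^ q : ℝ) : ℂ) * (lp.single 2 i (1 : ℂ) : L2) l
  rw [weighted]
  rcases eq_or_ne l i with rfl | h
  · simp
  · rw [lp.single_apply_ne _ _ _ h, mul_zero, mul_zero]

/-- Operators agreeing on `ℓ²` agree on the unit vectors, so all their weighted operators agree,
these being bounded on `ℓ²`. Every element of `s'` is a weight `D^q` applied to a vector of `ℓ²`.
Through this injectivity, algebraic identities in `L(s', s)` are checked in `L(ℓ²)`. -/
theorem iota_injective : Function.Injective iota := by
  intro x y h
  have h1 : ∀ i, x (j₂ (lp.single 2 i (1 : ℂ))) = y (j₂ (lp.single 2 i (1 : ℂ))) := fun i =>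
    j₁_injective (congrArg (fun T : L2 →L[ℂ] L2 => T (lp.single 2 i (1 : ℂ))) h)
  have h2 : ∀ q, weightedOp q x = weightedOp q y := fun q => ext_of_single fun i => by
    rw [weightedOp_apply, weightedOp_apply, ofWeighted_single, map_smul x, map_smul y, h1]
  ext1 η
  obtain ⟨q, hq⟩ := η.2
  refine toWeighted_injective q ?_
  have h3 := congrArg (fun T : L2 →L[ℂ] L2 => T (weightedL2 (-q) η hq)) (h2 q)
  have h4 : ∀ z : SmoothOp, weightedOp q z (weightedL2 (-q) η hq) = toWeighted q (z η) := fun z =>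
    congrArg (fun θ => toWeighted q (z θ)) (ofWeighted_weightedL2 q η hq)
  rwa [← h4, ← h4]

theorem pairing_ofWeighted (q : ℕ) (ξ : L2) (f : SSpace) :
    pairing (ofWeighted q ξ) f = inner ℂ (toWeighted q f) ξ := by
  rw [lp.inner_eq_tsum]
  refine tsum_congr fun j => ?_
  change weighted q ξ j * conj (f j) = inner ℂ (weighted q f j) (ξ j)
  simp only [weighted, RCLike.inner_apply, map_mul, Complex.conj_ofReal]
  ring

theorem weightedOp_rankOne (q : ℕ) (f : SSpace) :
    weightedOp q (rankOne f) =
      InnerProductSpace.rankOne ℂ (toWeighted q f) (toWeighted q f) := by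
  ext1 ξ
  have h : weightedOp q (rankOne f) ξ = toWeighted q (pairing (ofWeighted q ξ) f • f) := rfl
  rw [h, map_smul, pairing_ofWeighted, InnerProductSpace.rankOne_apply]

theorem toWeighted_zero (f : SSpace) : toWeighted 0 f = j₁ f :=
  Subtype.ext (weighted_zero_exponent _)

theorem iota_rankOne (f : SSpace) :
    iota (rankOne f) = InnerProductSpace.rankOne ℂ (j₁ f) (j₁ f) := by
  rw [← weightedOp_zero, weightedOp_rankOne, toWeighted_zero]

section Blocks

variable {f : ℕ → SSpace} {N : ℕ → Finset ℕ}

theorem iota_blockProj (f : ℕ → SSpace) (N : ℕ → Finset ℕ) (k : ℕ) :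
    iota (blockProj f N k) = ∑ j ∈ N k, InnerProductSpace.rankOne ℂ (j₁ (f j)) (j₁ (f j)) := by
  rw [← weightedOp_zero, blockProj, map_sum]
  exact Finset.sum_congr rfl fun j _ => by rw [weightedOp_zero, iota_rankOne]

theorem iota_blockProj_apply (k : ℕ) (ξ : L2) :
    iota (blockProj f N k) ξ = ∑ j ∈ N k, inner ℂ (j₁ (f j)) ξ • j₁ (f j) := by
  rw [iota_blockProj, sum_apply]
  rfl

theorem iota_blockProj_of_mem (hf : IsOrthonormalSeq f) {k j : ℕ} (hj : j ∈ N k) :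
    iota (blockProj f N k) (j₁ (f j)) = j₁ (f j) := by
  classical
  rw [iota_blockProj_apply, Finset.sum_eq_single j]
  · rw [inner_self_eq_norm_sq_to_K, hf.1 j]; simp
  · intro i _ hij
    rw [hf.2 hij, zero_smul]
  · exact fun h => absurd hj h

theorem iota_blockProj_of_notMem (hf : IsOrthonormalSeq f) {k j : ℕ} (hj : j ∉ N k) :
    iota (blockProj f N k) (j₁ (f j)) = 0 := by
  rw [iota_blockProj_apply]
  refine Finset.sum_eq_zero fun i hi => ?_
  have hij : i ≠ j := fun h => hj (h ▸ hi)
  rw [hf.2 hij, zero_smul]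

theorem star_blockProj (k : ℕ) : star (blockProj f N k) = blockProj f N k := by
  refine iota_injective ?_
  rw [iota_star, iota_blockProj, map_sum]
  simp

theorem blockProj_mul_self (hf : IsOrthonormalSeq f) (k : ℕ) :
    blockProj f N k * blockProj f N k = blockProj f N k := by
  refine iota_injective ?_
  ext1 ξ
  rw [iota_mul, ContinuousLinearMap.comp_apply, iota_blockProj_apply (ξ := ξ), map_sum]
  exact Finset.sum_congr rfl fun j hj => by rw [map_smul, iota_blockProj_of_mem hf hj]

theorem blockProj_mul_of_ne (hf : IsOrthonormalSeq f)
    (hd : Pairwise fun k l => Disjoint (N k) (N l)) {k l : ℕ} (hkl : k ≠ l) :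
    blockProj f N k * blockProj f N l = 0 := by
  refine iota_injective ?_
  ext1 ξ
  rw [iota_mul, ContinuousLinearMap.comp_apply, iota_blockProj_apply (ξ := ξ), map_sum, iota_zero]
  refine Finset.sum_eq_zero fun j hj => ?_
  rw [map_smul, iota_blockProj_of_notMem hf (Finset.disjoint_right.1 (hd hkl) hj), smul_zero]

theorem isStarProjection_blockProj (hf : IsOrthonormalSeq f) (k : ℕ) :
    IsStarProjection (blockProj f N k) :=
  ⟨blockProj_mul_self hf k, star_blockProj k⟩

theorem blockProj_ne_zero (hf : IsOrthonormalSeq f) (hN : ∀ k, (N k).Nonempty) (k : ℕ) :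
    blockProj f N k ≠ 0 := by
  obtain ⟨j, hj⟩ := hN k
  intro h
  have h1 := iota_blockProj_of_mem hf hj
  rw [h, iota_zero, zero_apply] at h1
  have h2 := hf.1 j
  simp [← h1] at h2

/-! ### Estimates for orthonormal sequences in `s` -/

theorem sNorm_le_of_le {q r : ℕ} (h : q ≤ r) (f : SSpace) : sNorm q f ≤ sNorm r f :=
  wNorm_mono (by exact_mod_cast h) (f.2 r)

/-- Cauchy–Schwarz applied to `⟨D^q f, D^q f⟩ = ⟨f, D^{2q} f⟩`. -/
theorem sNorm_sq_le (q : ℕ) (f : SSpace) : sNorm q f ^ 2 ≤ sNorm 0 f * sNorm (2 * q) f := by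
  have h : (inner ℂ (toWeighted q f) (toWeighted q f) : ℂ) =
      inner ℂ (toWeighted 0 f) (toWeighted (2 * q) f) := by
    rw [lp.inner_eq_tsum, lp.inner_eq_tsum]
    refine tsum_congr fun j => ?_
    change inner ℂ (weighted q f j) (weighted q f j) =
      inner ℂ (weighted (0 : ℕ) f j) (weighted (2 * q : ℕ) f j)
    simp only [weighted, RCLike.inner_apply, map_mul, Complex.conj_ofReal, zpow_natCast, pow_mul',
      pow_zero]
    push_cast
    ring
  have h1 := norm_inner_le_norm (𝕜 := ℂ) (toWeighted 0 f) (toWeighted (2 * q) f)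
  rw [← h, inner_self_eq_norm_sq_to_K, norm_toWeighted, norm_toWeighted, norm_toWeighted] at h1
  simpa using h1

/-- The dual norm `|f|'_1`, squared. -/
def negNormSq (f : SSpace) : ℝ := wNorm (-1) f ^ 2

theorem negNormSq_nonneg (f : SSpace) : 0 ≤ negNormSq f := sq_nonneg _

theorem sqSummable_neg_one (f : SSpace) : SqSummable (-1) f :=
  (f.2 0).mono (by norm_num)

/-- After exchanging the sums, the factor of `(i + 1)^{-2}` is `∑_j |⟨f_j, e_i⟩|²`, at most `1` by
Bessel. The bound depends on neither `s` nor `f`; it is the source of all summability over the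
blocks. -/
theorem sum_negNormSq_le (hf : IsOrthonormalSeq f) (s : Finset ℕ) :
    ∑ j ∈ s, negNormSq (f j) ≤ ∑' i : ℕ, 1 / ((i : ℝ) + 1) ^ 2 := by
  have h1 : ∀ j, negNormSq (f j) = ∑' i : ℕ, ‖f j i‖ ^ 2 * ((i : ℝ) + 1) ^ (2 * (-1) : ℤ) := by
    intro j
    rw [negNormSq, wNorm, Real.sq_sqrt (tsum_nonneg fun i => by positivity)]
  have h2 : ∑ j ∈ s, negNormSq (f j) =
      ∑' i : ℕ, ∑ j ∈ s, ‖f j i‖ ^ 2 * ((i : ℝ) + 1) ^ (2 * (-1) : ℤ) := by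
    rw [Summable.tsum_finsetSum fun j _ => sqSummable_neg_one (f j)]
    exact Finset.sum_congr rfl fun j _ => h1 j
  rw [h2]
  refine Summable.tsum_le_tsum (fun i => ?_) (summable_sum fun j _ => sqSummable_neg_one (f j))
    summable_inv_sq
  rw [← Finset.sum_mul]
  have h3 := hf.sum_inner_products_le (s := s) (lp.single 2 i (1 : ℂ) : L2)
  have h4 : ∀ j, ‖(inner ℂ (j₁ (f j)) (lp.single 2 i (1 : ℂ) : L2) : ℂ)‖ = ‖f j i‖ := by
    intro j
    rw [lp.inner_single_right]
    simp only [RCLike.inner_apply, one_mul, RCLike.norm_conj]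
    rfl
  simp only [h4] at h3
  have h5 : ‖(lp.single 2 i (1 : ℂ) : L2)‖ = 1 := by rw [lp.norm_single (by norm_num)]; simp
  rw [h5] at h3
  have h6 : ((i : ℝ) + 1) ^ (2 * (-1) : ℤ) = 1 / ((i : ℝ) + 1) ^ 2 := by
    rw [one_div, ← zpow_natCast, ← zpow_neg]; norm_num
  rw [h6]
  calc _ ≤ (1 : ℝ) ^ 2 * (1 / ((i : ℝ) + 1) ^ 2) := by gcongr
    _ = _ := by ring

/-- Duality gives `1 = ⟨f, f⟩ ≤ |f|'_1 |f|_1`, which allows the summable factor `|f|'_1²` to be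
inserted at the price of `|f|_1²`. The resulting product of norms is at most `|f|_{q+1}⁴`, and two
uses of `sNorm_sq_le` reduce it to the first power of a higher norm, as the Köthe matrix requires.
-/
theorem sNorm_sq_le_mul_negNormSq (q : ℕ) {f : SSpace} (hf : ‖j₁ f‖ = 1) :
    sNorm q f ^ 2 ≤ sNorm (4 * q + 4) f * negNormSq f := by
  have h0 : sNorm 0 f = 1 := by rw [← norm_toWeighted, toWeighted_zero, hf]
  have hsq : ∀ r, sNorm r f ^ 2 ≤ sNorm (2 * r) f := fun r => by
    simpa [h0] using sNorm_sq_le r f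
  have h1 : 1 ≤ wNorm (-1) f * sNorm 1 f := by
    have h2 := norm_pairing_le (t := 1) (sqSummable_neg_one f) (f.2 1)
    have h3 : pairing f f = inner ℂ (j₁ f) (j₁ f) := by
      rw [lp.inner_eq_tsum]
      exact tsum_congr fun i => rfl
    have h4 : sNorm 1 f = wNorm 1 f := by
      change wNorm ((1 : ℕ) : ℤ) f = _
      rw [Nat.cast_one]
    rw [h3, inner_self_eq_norm_sq_to_K, hf] at h2
    rw [h4]
    simpa using h2
  have hn : ∀ r, 0 ≤ sNorm r f := fun r => apply_nonneg _ _
  have h2 : 1 ≤ negNormSq f * sNorm 1 f ^ 2 := by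
    rw [negNormSq, ← mul_pow]
    exact one_le_pow₀ h1
  have h3 : sNorm q f ≤ sNorm (q + 1) f := sNorm_le_of_le (by omega) f
  have h4 : sNorm 1 f ≤ sNorm (q + 1) f := sNorm_le_of_le (by omega) f
  have h5 : (sNorm (q + 1) f ^ 2) ^ 2 ≤ sNorm (4 * q + 4) f := by
    have := hsq (2 * (q + 1))
    rw [show 2 * (2 * (q + 1)) = 4 * q + 4 by ring] at this
    exact (pow_le_pow_left₀ (sq_nonneg _) (hsq (q + 1)) 2).trans this
  have hneg := negNormSq_nonneg f
  calc sNorm q f ^ 2 = sNorm q f ^ 2 * 1 := by ring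
    _ ≤ sNorm q f ^ 2 * (negNormSq f * sNorm 1 f ^ 2) := by gcongr
    _ ≤ sNorm (q + 1) f ^ 2 * (negNormSq f * sNorm (q + 1) f ^ 2) := by
      have := hn q; have := hn 1; gcongr
    _ = (sNorm (q + 1) f ^ 2) ^ 2 * negNormSq f := by ring
    _ ≤ _ := by gcongr

/-! ### Norm estimates for blocks and for block series -/

theorem norm_weightedOp_rankOne (q : ℕ) (f : SSpace) :
    ‖weightedOp q (rankOne f)‖ = sNorm q f ^ 2 := by
  rw [weightedOp_rankOne, InnerProductSpace.norm_rankOne, norm_toWeighted, sq]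

theorem norm_weightedOp_blockProj_le (hf : IsOrthonormalSeq f) (hN : ∀ k, (N k).Nonempty)
    (q k : ℕ) : ‖weightedOp q (blockProj f N k)‖ ≤
      (maxMatrix f hf N hN).entry k (4 * q + 4) * ∑ j ∈ N k, negNormSq (f j) := by
  rw [blockProj, map_sum, Finset.mul_sum]
  refine (norm_sum_le _ _).trans (Finset.sum_le_sum fun j hj => ?_)
  rw [norm_weightedOp_rankOne]
  refine (sNorm_sq_le_mul_negNormSq q (hf.1 j)).trans ?_
  refine mul_le_mul_of_nonneg_right ?_ (negNormSq_nonneg _)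
  exact Finset.le_sup' (fun j => sNorm (4 * q + 4) (f j)) hj

theorem sum_block_negNormSq_le (hf : IsOrthonormalSeq f)
    (hd : Pairwise fun k l => Disjoint (N k) (N l)) (s : Finset ℕ) :
    ∑ k ∈ s, ∑ j ∈ N k, negNormSq (f j) ≤ ∑' i : ℕ, 1 / ((i : ℝ) + 1) ^ 2 := by
  classical
  rw [← Finset.sum_biUnion fun k _ l _ hkl => hd hkl]
  exact sum_negNormSq_le hf _

/-- The bound on a block is a Köthe weight times its share of the summable family `|f_j|'_1²`, so
the series converges absolutely in each norm. The explicit bound is kept because it later gives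
continuity of the inverse isomorphism and closedness of the block algebra. -/
theorem exists_hasSum_blockProj (hf : IsOrthonormalSeq f) (hN : ∀ k, (N k).Nonempty)
    (hd : Pairwise fun k l => Disjoint (N k) (N l)) {c : ℕ → ℂ}
    (hc : c ∈ kotheSubmodule (maxMatrix f hf N hN)) :
    ∃ y : SmoothOp, HasSum (fun k => c k • blockProj f N k) y ∧
      ∀ (q : ℕ) (M : ℝ), (∀ k, ‖c k‖ * (maxMatrix f hf N hN).entry k (4 * q + 4) ≤ M) →
        ‖weightedOp q y‖ ≤ M * ∑' i : ℕ, 1 / ((i : ℝ) + 1) ^ 2 := by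
  have hfin : ∀ (q : ℕ) (M : ℝ), (∀ k, ‖c k‖ * (maxMatrix f hf N hN).entry k (4 * q + 4) ≤ M) →
      ∀ s : Finset ℕ, ∑ k ∈ s, ‖weightedOp q (c k • blockProj f N k)‖ ≤
        M * ∑' i : ℕ, 1 / ((i : ℝ) + 1) ^ 2 := by
    intro q M hM s
    have hM0 : 0 ≤ M :=
      (mul_nonneg (norm_nonneg _) ((maxMatrix f hf N hN).nonneg 0 _)).trans (hM 0)
    refine le_trans ?_ (mul_le_mul_of_nonneg_left (sum_block_negNormSq_le hf hd s) hM0)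
    rw [Finset.mul_sum]
    refine Finset.sum_le_sum fun k _ => ?_
    rw [map_smul, norm_smul]
    refine (mul_le_mul_of_nonneg_left (norm_weightedOp_blockProj_le hf hN q k)
      (norm_nonneg _)).trans ?_
    rw [← mul_assoc]
    exact mul_le_mul_of_nonneg_right (hM k) (Finset.sum_nonneg fun j _ => negNormSq_nonneg _)
  have hsum : ∀ q, Summable fun k => ‖weightedOp q (c k • blockProj f N k)‖ := by
    intro q
    obtain ⟨M, hM⟩ := hc (4 * q + 4)
    exact summable_of_sum_le (fun _ => norm_nonneg _) (hfin q M fun k => hM ⟨k, rfl⟩)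
  obtain ⟨y, -, hy⟩ := exists_tendsto_of_weightedOp
    (x := fun n => ∑ k ∈ Finset.range n, c k • blockProj f N k)
    (T := fun q => ∑' k, weightedOp q (c k • blockProj f N k)) (fun q => by
      simp only [map_sum]
      exact (hsum q).of_norm.hasSum.tendsto_sum_nat)
  refine ⟨y, ?_, fun q M hM => ?_⟩
  · refine tendsto_smoothOp_iff.2 fun q => ?_
    rw [hy q]
    simp only [map_sum]
    exact (hsum q).of_norm.hasSum
  · rw [hy q]
    exact tsum_of_norm_bounded (hsum q).hasSum (fun _ => le_rfl) |>.trans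
      ((hsum q).tsum_le_of_sum_le (hfin q M hM))

/-- Eigenvalues of a smooth operator on the `f_j` satisfy the estimates of the Köthe space. -/
theorem norm_mul_entry_le (hf : IsOrthonormalSeq f) (hN : ∀ k, (N k).Nonempty) {x : SmoothOp}
    {k : ℕ} {c : ℂ} (hc : ∀ j ∈ N k, iota x (j₁ (f j)) = c • j₁ (f j)) (q : ℕ) :
    ‖c‖ * (maxMatrix f hf N hN).entry k q ≤ ‖weightedOp q x‖ := by
  -- The eigenvalue is common to the whole block, so it may be tested on the vector with the largest
  -- norm; there `|f_j|'_q ≤ |f_j|_0 = 1`.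
  obtain ⟨j, hj, hmax⟩ := Finset.exists_mem_eq_sup' (hN k) fun j => sNorm q (f j)
  have h1 : (maxMatrix f hf N hN).entry k q = sNorm q (f j) := hmax
  have h2 : x (j₂ (j₁ (f j))) = c • f j := by
    refine j₁_injective ?_
    rw [map_smul]
    exact hc j hj
  have h3 : SqSummable (-q) (j₂ (j₁ (f j))) := (sqSummable_L2 (j₁ (f j))).mono (by simp)
  have h4 := wNorm_apply_le q x (j₂ (j₁ (f j))) h3
  have h5 : wNorm (-q) (j₂ (j₁ (f j))) ≤ 1 := by
    have h6 : wNorm (-q) (j₁ (f j)) ≤ wNorm 0 (j₁ (f j)) :=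
      wNorm_mono (by simp) (sqSummable_L2 (j₁ (f j)))
    rw [wNorm_L2, hf.1 j] at h6
    exact h6
  rw [h2, map_smul_eq_mul] at h4
  rw [h1]
  exact h4.trans (mul_le_of_le_one_right (norm_nonneg _) h5)

end Blocks

end

section

/-! ### Spectral projections of compact self-adjoint operators -/

section Hilbert

variable {H : Type*} [NormedAddCommGroup H] [InnerProductSpace ℂ H] [CompleteSpace H]

/-- For self-adjoint operators the spectral radius is the norm and is attained in the spectrum;
compactness makes that nonzero spectral value an eigenvalue, and symmetry makes it real. -/
theorem exists_eigenvalue_norm {T : H →L[ℂ] H} (hc : IsCompactOperator T) (hs : IsSelfAdjoint T)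
    (h0 : T ≠ 0) : ∃ (μ : ℝ) (v : H), |μ| = ‖T‖ ∧ v ≠ 0 ∧ T v = (μ : ℂ) • v := by
  have hn : ‖T‖ ≠ 0 := norm_ne_zero_iff.2 h0
  have : Nontrivial (H →L[ℂ] H) := ⟨T, 0, h0⟩
  obtain ⟨z, hz, hz'⟩ := spectrum.exists_nnnorm_eq_spectralRadius T
  rw [T.spectralRadius_eq_nnnorm hs, ENNReal.coe_inj] at hz'
  have hz1 : ‖z‖ = ‖T‖ := congrArg NNReal.toReal hz'
  have hz0 : z ≠ 0 := by
    rintro rfl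
    exact hn (by simpa using hz1.symm)
  have hev := (hc.hasEigenvalue_iff_mem_spectrum hz0).2 hz
  have hreal := hs.isSymmetric.conj_eigenvalue_eq_self hev
  obtain ⟨v, hv⟩ := hev.exists_hasEigenvector
  obtain ⟨μ, rfl⟩ := Complex.conj_eq_iff_real.1 hreal
  refine ⟨μ, v, ?_, hv.2, hv.apply_eq_smul⟩
  rw [← hz1, Complex.norm_real, Real.norm_eq_abs]

/-- The powers of the normalized square of a compact self-adjoint operator converge in norm to a
spectral projection. -/
theorem exists_tendsto_pow {T : H →L[ℂ] H} (hc : IsCompactOperator T) (hs : IsSelfAdjoint T)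
    (h0 : T ≠ 0) : ∃ (μ : ℝ) (v : H) (Q : H →L[ℂ] H), μ ≠ 0 ∧ v ≠ 0 ∧ T v = (μ : ℂ) • v ∧
      IsStarProjection Q ∧ Q v = v ∧
      (((μ : ℂ) ^ 2)⁻¹ • (T * T)) * Q = Q ∧ Q * (((μ : ℂ) ^ 2)⁻¹ • (T * T)) = Q ∧
      Tendsto (fun n : ℕ => (((μ : ℂ) ^ 2)⁻¹ • (T * T)) ^ n) atTop (𝓝 Q) := by
  obtain ⟨μ, v, hμ, hv, hTv⟩ := exists_eigenvalue_norm hc hs h0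
  have hμ0 : μ ≠ 0 := by
    rintro rfl
    rw [abs_zero] at hμ
    exact h0 (norm_eq_zero.1 hμ.symm)
  have hμc : ((μ : ℂ) ^ 2) ≠ 0 := pow_ne_zero _ (by exact_mod_cast hμ0)
  set U : H →L[ℂ] H := ((μ : ℂ) ^ 2)⁻¹ • (T * T) with hU
  have hUc : IsCompactOperator U := (hc.comp_clm T).smul (((μ : ℂ) ^ 2)⁻¹)
  have hUs : IsSelfAdjoint U := by
    rw [IsSelfAdjoint, hU, star_smul, star_mul, hs.star_eq]
    simp
  -- `U` is positive, so `-1` is not an eigenvalue. This is why `T` is squared: powers of `T / μ`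
  -- itself could oscillate.
  have hUpos : ∀ w : H, U w = -w → w = 0 := by
    intro w hw
    have h1 : (inner ℂ (U w) w : ℂ) = ((μ : ℂ) ^ 2)⁻¹ * (‖T w‖ : ℂ) ^ 2 := by
      have h2 : (inner ℂ (T (T w)) w : ℂ) = inner ℂ (T w) (T w) := hs.isSymmetric (T w) w
      have h3 : U w = ((μ : ℂ) ^ 2)⁻¹ • T (T w) := rfl
      rw [h3, inner_smul_left, h2, inner_self_eq_norm_sq_to_K]
      simp
    rw [hw, inner_neg_left, inner_self_eq_norm_sq_to_K] at h1
    have h4 : -‖w‖ ^ 2 = (μ ^ 2)⁻¹ * ‖T w‖ ^ 2 :=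
      Complex.ofReal_injective (by simpa using h1)
    have h5 : 0 ≤ (μ ^ 2)⁻¹ * ‖T w‖ ^ 2 := by positivity
    have h6 : ‖w‖ ^ 2 = 0 := le_antisymm (by linarith) (sq_nonneg _)
    exact norm_eq_zero.1 (pow_eq_zero_iff (two_ne_zero) |>.1 h6)
  have hUn : ‖U‖ ≤ 1 := by
    rw [hU, norm_smul, norm_inv, norm_pow, Complex.norm_real, Real.norm_eq_abs, hμ]
    have h1 : ‖T * T‖ ≤ ‖T‖ ^ 2 := by rw [sq]; exact norm_mul_le _ _
    have h2 : 0 < ‖T‖ ^ 2 := by have := norm_pos_iff.2 h0; positivity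
    rwa [inv_mul_le_iff₀ h2, mul_one]
  set K := Module.End.eigenspace U.toLinearMap (1 : ℂ) with hK
  have hmemK : ∀ w, w ∈ K ↔ U w = w := fun w => by
    rw [hK, Module.End.mem_eigenspace_iff, one_smul]; rfl
  have : FiniteDimensional ℂ K :=
    ContinuousLinearMap.finite_dimensional_eigenspace hUc 1 one_ne_zero
  set Q : H →L[ℂ] H := K.starProjection with hQ
  have hQs : IsStarProjection Q := isStarProjection_starProjection
  have hUQ : U * Q = Q := by
    ext1 w
    exact (hmemK _).1 (Submodule.starProjection_apply_mem K w)
  have hQU : Q * U = Q := by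
    have := congrArg star hUQ
    rwa [star_mul, hUs.star_eq, hQs.isSelfAdjoint.star_eq] at this
  have hQQ : Q * Q = Q := hQs.isIdempotentElem
  have hQK : ∀ w, U w = w → Q w = w := fun w hw =>
    Submodule.starProjection_eq_self_iff.2 ((hmemK w).2 hw)
  set R := U - Q with hR
  have hQR : Q * R = 0 := by rw [hR, mul_sub, hQU, hQQ, sub_self]
  have hRQ : R * Q = 0 := by rw [hR, sub_mul, hUQ, hQQ, sub_self]
  -- The norm of the compact self-adjoint `R` is `|ν|` for an eigenvalue `ν`. An eigenvector for `ν
  -- ≠ 0` is killed by `Q`, so it is an eigenvector of `U` orthogonal to the fixed space. This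
  -- excludes `ν = 1`, and positivity excludes `ν = -1`.
  have hRn : ‖R‖ < 1 := by
    rcases eq_or_ne R 0 with hR0 | hR0
    · rw [hR0, norm_zero]; exact zero_lt_one
    have hQc : IsCompactOperator Q := by
      have : Q = U * Q := hUQ.symm
      rw [this]
      exact hUc.comp_clm Q
    have hRc : IsCompactOperator R := hUc.sub hQc
    have hRs : IsSelfAdjoint R := hUs.sub hQs.isSelfAdjoint
    obtain ⟨ν, w, hν, hw, hRw⟩ := exists_eigenvalue_norm hRc hRs hR0
    have hν0 : (ν : ℂ) ≠ 0 := by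
      intro h
      have : ν = 0 := by exact_mod_cast h
      rw [this, abs_zero] at hν
      exact hR0 (norm_eq_zero.1 hν.symm)
    have hQw : Q w = 0 := by
      have h1 : Q (R w) = 0 := congrArg (fun S : H →L[ℂ] H => S w) hQR
      rw [hRw, map_smul] at h1
      exact (smul_eq_zero.1 h1).resolve_left hν0
    have hUw : U w = (ν : ℂ) • w := by
      have h1 : R w = U w - Q w := rfl
      rw [hQw, sub_zero] at h1
      rw [← h1, hRw]
    have hle : |ν| ≤ 1 := by
      have h1 := U.le_of_opNorm_le hUn w
      rw [hUw, norm_smul, Complex.norm_real, Real.norm_eq_abs] at h1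
      exact le_of_mul_le_mul_right h1 (norm_pos_iff.2 hw)
    rw [← hν]
    refine lt_of_le_of_ne hle fun habs => ?_
    rcases (abs_eq zero_le_one).1 habs with h | h
    · rw [h, Complex.ofReal_one, one_smul] at hUw
      exact hw ((hQK w hUw).symm.trans hQw)
    · rw [h] at hUw
      exact hw (hUpos w (by simpa using hUw))
  -- Exponents start at `1`, since at exponent `0` the identity would read `1 = Q + 1`.
  have hpow : ∀ n : ℕ, U ^ (n + 1) = Q + R ^ (n + 1) := by
    intro n
    induction n with
    | zero => simp [hR]
    | succ n ih =>
      have h1 : U = Q + R := by rw [hR]; abel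
      rw [pow_succ, ih]
      nth_rewrite 1 [h1]
      have h2 : R ^ (n + 1) * Q = 0 := by rw [pow_succ, mul_assoc, hRQ, mul_zero]
      rw [mul_add, add_mul, add_mul, hQQ, h2, hQR, ← pow_succ]
      abel
  refine ⟨μ, v, Q, hμ0, hv, hTv, hQs, hQK v ?_, hUQ, hQU, ?_⟩
  · change ((μ : ℂ) ^ 2)⁻¹ • T (T v) = v
    rw [hTv, map_smul, hTv, smul_smul, smul_smul, mul_assoc, ← sq, inv_mul_cancel₀ hμc, one_smul]
  · rw [← tendsto_add_atTop_iff_nat 1]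
    change Tendsto (fun n : ℕ => U ^ (n + 1)) atTop (𝓝 Q)
    simp only [hpow]
    have h1 := (tendsto_add_atTop_iff_nat 1).2 (tendsto_pow_atTop_nhds_zero_of_norm_lt_one hRn)
    simpa using h1.const_add Q

end Hilbert

/-! ### Smooth operators are compact -/

theorem norm_iota_single_le (x : SmoothOp) : ∃ C : ℝ, ∀ i : ℕ,
    ‖iota x (lp.single 2 i (1 : ℂ))‖ ≤ C * (1 / ((i : ℝ) + 1) ^ 2) := by
  obtain ⟨C, -, hC⟩ := exists_bound x 0 2
  refine ⟨C, fun i => ?_⟩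
  have h1 := hC (unitSDual i) (hasSum_unit _ i).summable
  rw [wNorm_unit] at h1
  have h2 : ‖iota x (lp.single 2 i (1 : ℂ))‖ = wNorm (0 : ℕ) (x (unitSDual i)) :=
    (wNorm_L2 (j₁ (x (unitSDual i)))).symm
  rw [h2, one_div, ← zpow_natCast, ← zpow_neg]
  exact h1

theorem isCompactOperator_rankOne {H : Type*} [NormedAddCommGroup H] [InnerProductSpace ℂ H]
    (u v : H) : IsCompactOperator (InnerProductSpace.rankOne ℂ u v) := by
  rw [InnerProductSpace.rankOne_def']
  exact (isCompactOperator_of_locallyCompactSpace_dom (innerSL ℂ v)).clm_comp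
    (ContinuousLinearMap.toSpanSingleton ℂ u)

/-- The images of the unit vectors have summable norms, so `iota x = ∑ ⟨·, e_i⟩ x e_i` is a norm
limit of finite rank operators. -/
theorem isCompactOperator_iota (x : SmoothOp) : IsCompactOperator (iota x) := by
  obtain ⟨C, hC⟩ := norm_iota_single_le x
  let F : ℕ → L2 →L[ℂ] L2 := fun i =>
    InnerProductSpace.rankOne ℂ (iota x (lp.single 2 i (1 : ℂ))) (lp.single 2 i (1 : ℂ) : L2)
  have hone : ∀ i : ℕ, ‖(lp.single 2 i (1 : ℂ) : L2)‖ = 1 := fun i => by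
    rw [lp.norm_single (by norm_num)]; simp
  have hF : Summable F := by
    refine Summable.of_norm_bounded (summable_inv_sq.mul_left C) fun i => ?_
    rw [InnerProductSpace.norm_rankOne, hone, mul_one]
    exact hC i
  have hsum : ∑' i, F i = iota x := by
    refine ext_of_single fun l => ?_
    have h1 := hF.hasSum.mapL (ContinuousLinearMap.apply ℂ L2 (lp.single 2 l (1 : ℂ) : L2))
    have h2 : ∀ i, i ≠ l → (ContinuousLinearMap.apply ℂ L2 (lp.single 2 l (1 : ℂ) : L2)) (F i) = 0 := by
      intro i hi
      change InnerProductSpace.rankOne ℂ _ _ _ = _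
      rw [InnerProductSpace.rankOne_apply, lp.inner_single_left, lp.single_apply_ne _ _ _ hi]
      simp
    have h3 := h1.unique (hasSum_single l h2)
    refine h3.trans ?_
    change InnerProductSpace.rankOne ℂ _ _ _ = _
    rw [InnerProductSpace.rankOne_apply, inner_self_eq_norm_sq_to_K, hone]
    simp
  rw [← hsum]
  exact isCompactOperator_of_tendsto hF.hasSum (Eventually.of_forall fun s =>
    Submodule.sum_mem (compactOperator (RingHom.id ℂ) L2 L2) fun i _ =>
      isCompactOperator_rankOne _ _)

/-! ### Projections in closed commutative subalgebras -/

theorem isStarProjection_iff_iota {P : SmoothOp} :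
    IsStarProjection P ↔ IsStarProjection (iota P) := by
  constructor
  · rintro ⟨h1, h2⟩
    refine ⟨congrArg iota h1, ?_⟩
    rw [IsSelfAdjoint, ContinuousLinearMap.star_eq_adjoint, ← iota_star]
    exact congrArg iota h2
  · rintro ⟨h1, h2⟩
    refine ⟨iota_injective h1, iota_injective ?_⟩
    rw [iota_star]
    exact h2

variable {E : NonUnitalStarSubalgebra ℂ SmoothOp}

/-- The outer smooth factors absorb the weights, so `z` enters only through its action on `ℓ²`. -/
theorem weightedOp_mul_mul (q : ℕ) (x z : SmoothOp) : weightedOp q (x * z * x) =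
    ((toWeighted q).comp (x.comp j₂)).comp
      ((iota z).comp (j₁.comp (x.comp (ofWeighted q)))) := rfl

/-- If `z_n ∈ E` converges in `L(ℓ²)`, then `x z_n x` converges in `L(s', s)`. -/
theorem exists_mem_iota_eq (hE : IsClosed (E : Set SmoothOp)) {x : SmoothOp} (hx : x ∈ E)
    {z : ℕ → SmoothOp} (hz : ∀ n, z n ∈ E) {T : L2 →L[ℂ] L2}
    (hT : Tendsto (fun n => iota (z n)) atTop (𝓝 T)) :
    ∃ w ∈ E, iota w = iota x * T * iota x := by
  have h : ∀ q, Tendsto (fun n => weightedOp q (x * z n * x)) atTop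
      (𝓝 (((toWeighted q).comp (x.comp j₂)).comp (T.comp (j₁.comp (x.comp (ofWeighted q)))))) :=
    fun q => by
      simp only [weightedOp_mul_mul]
      exact ((continuous_const.clm_comp (continuous_id.clm_comp continuous_const)).tendsto T).comp hT
  obtain ⟨w, hw, hw'⟩ := exists_tendsto_of_weightedOp h
  refine ⟨w, hE.mem_of_tendsto hw (Eventually.of_forall fun n =>
    mul_mem (mul_mem hx (hz n)) hx), ?_⟩
  have h1 : Tendsto (fun n => iota (x * z n * x)) atTop (𝓝 (iota w)) :=
    (continuous_iota.tendsto w).comp hw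
  have h2 : Tendsto (fun n => iota x * iota (z n) * iota x) atTop (𝓝 (iota x * T * iota x)) :=
    (hT.const_mul _).mul_const _
  exact tendsto_nhds_unique h1 h2

/-- A nonzero self-adjoint element of `E` has a nonzero eigenvalue with a spectral projection
in `E`. -/
theorem exists_spectralProjection (hE : IsInfDimClosedComm E) {y : SmoothOp} (hy : y ∈ E)
    (hys : star y = y) (hy0 : y ≠ 0) :
    ∃ (μ : ℂ) (P : SmoothOp), μ ≠ 0 ∧ P ∈ E ∧ IsStarProjection P ∧ P ≠ 0 ∧ y * P = μ • P := by
  have hT0 : iota y ≠ 0 := fun h => hy0 (iota_injective (h.trans iota_zero.symm))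
  have hTs : IsSelfAdjoint (iota y) := by
    rw [IsSelfAdjoint, ContinuousLinearMap.star_eq_adjoint, ← iota_star, hys]
  obtain ⟨μ, v, Q, hμ, hv, hTv, hQ, hQv, hUQ, hQU, hlim⟩ :=
    exists_tendsto_pow (isCompactOperator_iota y) hTs hT0
  have hμc : (μ : ℂ) ≠ 0 := by exact_mod_cast hμ
  set T := iota y with hT
  set u : SmoothOp := ((μ : ℂ) ^ 2)⁻¹ • (y * y) with hu
  have huE : u ∈ E := SMulMemClass.smul_mem _ (mul_mem hy hy)
  have hιu : iota u = ((μ : ℂ) ^ 2)⁻¹ • (T * T) := iota_smul _ _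
  -- `E` has no unit, so only positive powers are available.
  have hpow : ∀ n : ℕ, ∃ z ∈ E, iota z = (((μ : ℂ) ^ 2)⁻¹ • (T * T)) ^ (n + 1) := by
    intro n
    induction n with
    | zero => exact ⟨u, huE, by rw [hιu, zero_add, pow_one]⟩
    | succ n ih =>
      obtain ⟨z, hz, hz'⟩ := ih
      refine ⟨z * u, mul_mem hz huE, ?_⟩
      rw [pow_succ, ← hz', ← hιu]
      exact iota_mul z u
  choose z hz hz' using hpow
  -- Sandwiching by `u` does not change the limit, because `u Q = Q = Q u` on `ℓ²`; thus `Q` itself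
  -- comes from an element of `E`.
  obtain ⟨w, hw, hw'⟩ := exists_mem_iota_eq hE.isClosed huE hz (T := Q) (by
    simp only [hz']
    exact (tendsto_add_atTop_iff_nat 1).2 hlim)
  rw [hιu, hUQ, hQU] at hw'
  have hcomm : T * Q = Q * T := by
    rw [← hw', hT]
    exact congrArg iota (hE.comm y hy w hw)
  have hTTQ : T * (T * Q) = ((μ : ℂ) ^ 2) • Q := by
    rw [smul_mul_assoc, mul_assoc, inv_smul_eq_iff₀ (pow_ne_zero _ hμc)] at hUQ
    exact hUQ
  have hQQ : Q * Q = Q := hQ.isIdempotentElem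
  have hQTQ : Q * (T * Q) = T * Q := by rw [hcomm, ← mul_assoc, hQQ]
  have hTQTQ : T * Q * (T * Q) = ((μ : ℂ) ^ 2) • Q := by rw [mul_assoc, hQTQ, hTTQ]
  have hTQQ : T * Q * Q = T * Q := by rw [mul_assoc, hQQ]
  -- On the range of `Q` one has `T² = μ²`, so both `μ` and `-μ` may occur; the factor `(1 + T / μ)
  -- / 2` selects `μ`.
  set P : SmoothOp := (2⁻¹ : ℂ) • (w + (μ : ℂ)⁻¹ • (y * w)) with hP
  have hιP : iota P = (2⁻¹ : ℂ) • (Q + (μ : ℂ)⁻¹ • (T * Q)) := by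
    rw [hP, iota_smul, iota_add, iota_smul, hw']
    congr 3
    rw [← hw']
    exact iota_mul y w
  have hTP : T * iota P = (μ : ℂ) • iota P := by
    rw [hιP, mul_smul_comm, mul_add, mul_smul_comm, hTTQ]
    match_scalars <;> field_simp
  refine ⟨μ, P, hμc, SMulMemClass.smul_mem _ (add_mem hw (SMulMemClass.smul_mem _
    (mul_mem hy hw))), isStarProjection_iff_iota.2 ⟨?_, ?_⟩, ?_, iota_injective ?_⟩
  · rw [IsIdempotentElem, hιP, smul_mul_smul_comm, mul_add, add_mul, add_mul, hQQ,
      smul_mul_smul_comm, hTQTQ, mul_smul_comm, smul_mul_assoc, hQTQ, hTQQ, smul_smul]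
    have h1 : ((μ : ℂ)⁻¹ * (μ : ℂ)⁻¹ * (μ : ℂ) ^ 2) = 1 := by field_simp
    rw [h1]
    module
  · have h1 : star (T * Q) = T * Q := by
      rw [star_mul, hTs.star_eq, hQ.isSelfAdjoint.star_eq, hcomm]
    rw [IsSelfAdjoint, hιP, star_smul, star_add, star_smul, h1, hQ.isSelfAdjoint.star_eq]
    simp
  · intro hP0
    have h1 : iota P v = v := by
      rw [hιP]
      change (2⁻¹ : ℂ) • (Q v + (μ : ℂ)⁻¹ • T (Q v)) = v
      rw [hQv, hTv, smul_smul, inv_mul_cancel₀ hμc]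
      module
    rw [hP0, iota_zero] at h1
    exact hv h1.symm
  · rw [iota_smul]
    exact hTP

end

section

/-! ### The involution, and minimal projections of a closed commutative subalgebra -/

theorem star_star_smoothOp (x : SmoothOp) : star (star x) = x :=
  iota_injective (by rw [iota_star, iota_star, ContinuousLinearMap.adjoint_adjoint])

theorem star_add_smoothOp (x y : SmoothOp) : star (x + y) = star x + star y :=
  iota_injective (by rw [iota_star, iota_add, iota_add, iota_star, iota_star, map_add])

theorem star_smul_smoothOp (c : ℂ) (x : SmoothOp) : star (c • x) = conj c • star x :=
  iota_injective (by rw [iota_star, iota_smul, iota_smul, iota_star, map_smulₛₗ])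

theorem star_mul_smoothOp (x y : SmoothOp) : star (x * y) = star y * star x :=
  iota_injective (by
    rw [iota_star, iota_mul, iota_mul, iota_star, iota_star, ContinuousLinearMap.adjoint_comp])

theorem smul_mul_smoothOp (c : ℂ) (x y : SmoothOp) : (c • x) * y = c • (x * y) := rfl

theorem mul_smul_smoothOp (c : ℂ) (x y : SmoothOp) : x * (c • y) = c • (x * y) := by
  simp only [mul_def, ContinuousLinearMap.comp_smul]

/-- The range lies in the eigenspace of a compact operator for the eigenvalue `1`. -/
theorem finiteDimensional_range_iota {P : SmoothOp} (hP : P * P = P) :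
    FiniteDimensional ℂ (iota P).range := by
  have h := ContinuousLinearMap.finite_dimensional_eigenspace (isCompactOperator_iota P) 1
    one_ne_zero
  refine Submodule.finiteDimensional_of_le (S₂ := Module.End.eigenspace (iota P).toLinearMap 1) ?_
  rintro _ ⟨ξ, rfl⟩
  rw [Module.End.mem_eigenspace_iff, one_smul]
  exact congrArg (fun T : L2 →L[ℂ] L2 => T ξ) (congrArg iota hP)

variable {E : NonUnitalStarSubalgebra ℂ SmoothOp}

/-- A nonzero projection of least rank among those of `E` below `Q` is minimal: a nonzero projection
below it has the same finite-dimensional range. -/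
theorem exists_minimalProjection_le {Q : SmoothOp} (hQ : Q ∈ E)
    (hQs : IsStarProjection Q) (hQ0 : Q ≠ 0) :
    ∃ P, IsMinimalProjection E P ∧ P * Q = P := by
  classical
  let S : ℕ → Prop := fun n => ∃ P ∈ E, IsStarProjection P ∧ P ≠ 0 ∧ P * Q = P ∧
    Module.finrank ℂ (iota P).range = n
  have hS : ∃ n, S n := ⟨_, Q, hQ, hQs, hQ0, hQs.isIdempotentElem, rfl⟩
  obtain ⟨P, hP, hPs, hP0, hPQ, hPn⟩ := Nat.find_spec hS
  refine ⟨P, ⟨hP, hPs, hP0, fun R hR hRs hRP hPR => ?_⟩, hPQ⟩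
  by_cases hR0 : R = 0
  · exact Or.inl hR0
  right
  have hRQ : R * Q = R := by rw [← hRP, mul_assoc, hPQ]
  have h1 : Nat.find hS ≤ Module.finrank ℂ (iota R).range :=
    Nat.find_min' hS ⟨R, hR, hRs, hR0, hRQ, rfl⟩
  rw [← hPn] at h1
  have hle : (iota R).range ≤ (iota P).range := by
    rintro _ ⟨ξ, rfl⟩
    exact ⟨iota R ξ, congrArg (fun T : L2 →L[ℂ] L2 => T ξ) (congrArg iota hPR)⟩
  have := finiteDimensional_range_iota hPs.isIdempotentElem
  have heq := Submodule.eq_of_le_of_finrank_le hle h1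
  have hRP' : R * P = P := by
    refine iota_injective ?_
    ext1 ξ
    have hmem : iota P ξ ∈ (iota R).range := heq ▸ ⟨ξ, rfl⟩
    obtain ⟨ζ, hζ⟩ := hmem
    change iota R ζ = iota P ξ at hζ
    change iota R (iota P ξ) = iota P ξ
    rw [← hζ]
    exact congrArg (fun T : L2 →L[ℂ] L2 => T ζ) (congrArg iota hRs.isIdempotentElem)
  rw [← hRP, hRP']

/-- If `z ≠ 0`, then `z* z ≠ 0` by the C*-identity, and it acts as some `μ ≠ 0` on a projection of
`E`. Below that projection lies a minimal `P`, for which `z* z P = μ P ≠ 0`, contradicting `z P =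
0`. -/
theorem eq_zero_of_mul_minimalProjection (hE : IsInfDimClosedComm E) {z : SmoothOp} (hz : z ∈ E)
    (h : ∀ P, IsMinimalProjection E P → z * P = 0) : z = 0 := by
  by_contra hz0
  have hy0 : star z * z ≠ 0 := by
    intro h0
    have h1 : star (iota z) * iota z = 0 := by
      rw [ContinuousLinearMap.star_eq_adjoint, ← iota_star, ← iota_zero, ← h0]
      exact (iota_mul _ _).symm
    have h2 : iota z = 0 := (CStarRing.star_mul_self_eq_zero_iff (iota z)).1 h1
    exact hz0 (iota_injective (h2.trans iota_zero.symm))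
  have hys : star (star z * z) = star z * z := by rw [star_mul_smoothOp, star_star_smoothOp]
  obtain ⟨μ, Q, hμ, hQ, hQs, hQ0, hyQ⟩ :=
    exists_spectralProjection hE (mul_mem (star_mem hz) hz) hys hy0
  obtain ⟨P, hP, hPQ⟩ := exists_minimalProjection_le hQ hQs hQ0
  have hQP : Q * P = P := by rw [hE.comm Q hQ P hP.mem, hPQ]
  have h1 := congrArg (· * P) hyQ
  simp only [smul_mul_smoothOp, mul_assoc, hQP, h P hP, mul_zero] at h1
  exact hP.ne_zero ((smul_eq_zero.1 h1.symm).resolve_left hμ)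

/-- For self-adjoint `a` with `a P ≠ 0`, a spectral projection of `a P` lies below `P`, hence equals
`P` by minimality. The general case follows by splitting `x` into self-adjoint parts. -/
theorem exists_smul_of_isMinimalProjection (hE : IsInfDimClosedComm E) {x P : SmoothOp}
    (hx : x ∈ E) (hP : IsMinimalProjection E P) : ∃ c : ℂ, x * P = c • P := by
  have hPP : P * P = P := hP.isStarProjection.isIdempotentElem
  have hPs : star P = P := hP.isStarProjection.isSelfAdjoint
  have key : ∀ a ∈ E, star a = a → ∃ c : ℂ, a * P = c • P := by
    intro a ha has
    by_cases h0 : a * P = 0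
    · exact ⟨0, by rw [h0, zero_smul]⟩
    have hs : star (a * P) = a * P := by
      rw [star_mul_smoothOp, has, hPs, hE.comm a ha P hP.mem]
    obtain ⟨μ, Q, hμ, hQ, hQs, hQ0, hyQ⟩ :=
      exists_spectralProjection hE (mul_mem ha hP.mem) hs h0
    have hQP : Q * P = Q := by
      have h1 : μ • (Q * P) = μ • Q := by
        rw [← smul_mul_smoothOp, ← hyQ, mul_assoc, hE.comm Q hQ P hP.mem, ← mul_assoc,
          mul_assoc a, hPP]
      exact smul_right_injective _ hμ h1
    rcases hP.minimal Q hQ hQs hQP ((hE.comm P hP.mem Q hQ).trans hQP) with h | h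
    · exact absurd h hQ0
    · refine ⟨μ, ?_⟩
      rw [h, mul_assoc, hPP] at hyQ
      exact hyQ
  have hsx : star x ∈ E := star_mem hx
  obtain ⟨c, hc⟩ := key ((2⁻¹ : ℂ) • (x + star x)) (SMulMemClass.smul_mem _ (add_mem hx hsx)) (by
    rw [star_smul_smoothOp, star_add_smoothOp, star_star_smoothOp, add_comm, map_inv₀,
      Complex.conj_ofNat])
  -- This is minus the usual imaginary part, so `x` is the first part minus `i` times this one.
  obtain ⟨d, hd⟩ := key ((2⁻¹ * Complex.I : ℂ) • (x + (-1 : ℂ) • star x))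
    (SMulMemClass.smul_mem _ (add_mem hx (SMulMemClass.smul_mem _ hsx))) (by
      rw [star_smul_smoothOp, star_add_smoothOp, star_smul_smoothOp, star_star_smoothOp]
      simp only [map_mul, map_inv₀, Complex.conj_I, map_neg, map_one, Complex.conj_ofNat]
      module)
  refine ⟨c - Complex.I * d, ?_⟩
  have h1 : x = (2⁻¹ : ℂ) • (x + star x) -
      Complex.I • ((2⁻¹ * Complex.I : ℂ) • (x + (-1 : ℂ) • star x)) := by
    have hI : Complex.I * (2⁻¹ * Complex.I) = -2⁻¹ := by
      rw [mul_left_comm, Complex.I_mul_I]; ring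
    rw [smul_smul, hI]
    module
  rw [h1, sub_mul, smul_mul_smoothOp Complex.I, hc, hd]
  module

/-! ### Block diagonal operators -/

section Diagonal

variable {f : ℕ → SSpace} {N : ℕ → Finset ℕ}

theorem iota_eq_smul_of_mul_blockProj (hf : IsOrthonormalSeq f) {x : SmoothOp} {k : ℕ} {c : ℂ}
    (h : x * blockProj f N k = c • blockProj f N k) {j : ℕ} (hj : j ∈ N k) :
    iota x (j₁ (f j)) = c • j₁ (f j) := by
  have h1 := congrArg (fun z => iota z (j₁ (f j))) h
  simp only [iota_smul, iota_mul, ContinuousLinearMap.comp_apply, smul_apply,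
    iota_blockProj_of_mem hf hj] at h1
  exact h1

/-- The coefficient of `x` at the block `k`, i.e. `⟨x f_j, f_j⟩` for some `j ∈ N_k`. -/
def blockCoeff (f : ℕ → SSpace) (hN : ∀ k, (N k).Nonempty) (x : SmoothOp) (k : ℕ) : ℂ :=
  inner ℂ (j₁ (f (hN k).choose)) (iota x (j₁ (f (hN k).choose)))

theorem blockCoeff_add (hN : ∀ k, (N k).Nonempty) (x y : SmoothOp) :
    blockCoeff f hN (x + y) = blockCoeff f hN x + blockCoeff f hN y := by
  funext k
  rw [blockCoeff, iota_add, add_apply, inner_add_right]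
  rfl

theorem blockCoeff_smul (hN : ∀ k, (N k).Nonempty) (c : ℂ) (x : SmoothOp) :
    blockCoeff f hN (c • x) = c • blockCoeff f hN x := by
  funext k
  rw [blockCoeff, iota_smul, smul_apply, inner_smul_right]
  rfl

theorem blockCoeff_star (hN : ∀ k, (N k).Nonempty) (x : SmoothOp) (k : ℕ) :
    blockCoeff f hN (star x) k = conj (blockCoeff f hN x k) := by
  rw [blockCoeff, iota_star, ContinuousLinearMap.adjoint_inner_right, ← inner_conj_symm]
  rfl

theorem continuous_blockCoeff (hN : ∀ k, (N k).Nonempty) (k : ℕ) :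
    Continuous fun x => blockCoeff f hN x k := by
  unfold blockCoeff
  exact continuous_const.inner (continuous_iota.clm_apply continuous_const)

theorem blockCoeff_eq (hf : IsOrthonormalSeq f) (hN : ∀ k, (N k).Nonempty) {x : SmoothOp} {k : ℕ}
    {c : ℂ} (h : x * blockProj f N k = c • blockProj f N k) : blockCoeff f hN x k = c := by
  rw [blockCoeff, iota_eq_smul_of_mul_blockProj hf h (hN k).choose_spec, inner_smul_right,
    inner_self_eq_norm_sq_to_K, hf.1]
  simp

/-- Right multiplication by `P_k` is continuous and sends all partial sums beyond `k` to `c_k P_k`.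
Only convergence of ordered partial sums is assumed, which is what uniqueness of a Schauder
expansion requires. -/
theorem mul_blockProj_of_tendsto (hf : IsOrthonormalSeq f)
    (hd : Pairwise fun k l => Disjoint (N k) (N l)) {c : ℕ → ℂ} {x : SmoothOp}
    (h : Tendsto (fun n => ∑ k ∈ Finset.range n, c k • blockProj f N k) atTop (𝓝 x)) (k : ℕ) :
    x * blockProj f N k = c k • blockProj f N k := by
  classical
  have h1 : Tendsto (fun n => (∑ l ∈ Finset.range n, c l • blockProj f N l) * blockProj f N k)
      atTop (𝓝 (x * blockProj f N k)) :=
    ((ContinuousLinearMap.precomp SSpace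
      ((j₂.comp j₁).comp (blockProj f N k))).continuous.tendsto x).comp h
  refine tendsto_nhds_unique h1 (tendsto_const_nhds.congr' ?_)
  filter_upwards [eventually_gt_atTop k] with n hn
  rw [Finset.sum_mul, Finset.sum_eq_single k]
  · rw [smul_mul_smoothOp, blockProj_mul_self hf]
  · intro l _ hlk
    rw [smul_mul_smoothOp, blockProj_mul_of_ne hf hd hlk, smul_zero]
  · intro h
    exact absurd (Finset.mem_range.2 hn) h

theorem blockCoeff_mem (hf : IsOrthonormalSeq f) (hN : ∀ k, (N k).Nonempty) {x : SmoothOp}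
    (h : ∀ k, x * blockProj f N k = blockCoeff f hN x k • blockProj f N k) :
    blockCoeff f hN x ∈ kotheSubmodule (maxMatrix f hf N hN) := fun q =>
  ⟨‖weightedOp q x‖, by
    rintro _ ⟨k, rfl⟩
    exact norm_mul_entry_le hf hN (fun j hj => iota_eq_smul_of_mul_blockProj hf (h k) hj) q⟩

end Diagonal

end

section

variable {E : NonUnitalStarSubalgebra ℂ SmoothOp} {f : ℕ → SSpace} {N : ℕ → Finset ℕ}

/-! ### The isomorphism with the Köthe algebra -/

theorem mem_of_hasSum_blockProj (hE : IsClosed (E : Set SmoothOp)) (hP : ∀ k, blockProj f N k ∈ E)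
    {c : ℕ → ℂ} {x : SmoothOp} (h : HasSum (fun k => c k • blockProj f N k) x) : x ∈ E :=
  hE.mem_of_tendsto h (Eventually.of_forall fun _ =>
    sum_mem fun k _ => SMulMemClass.smul_mem _ (hP k))

theorem mul_blockProj_eq (hE : IsInfDimClosedComm E) (hf : IsOrthonormalSeq f)
    (hN : ∀ k, (N k).Nonempty) (hB : IsCanonicalBasis E (blockProj f N)) {x : SmoothOp}
    (hx : x ∈ E) (k : ℕ) :
    x * blockProj f N k = blockCoeff f hN x k • blockProj f N k := by
  have hP : IsMinimalProjection E (blockProj f N k) := hB.range_eq.le ⟨k, rfl⟩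
  obtain ⟨c, hc⟩ := exists_smul_of_isMinimalProjection hE hx hP
  rw [blockCoeff_eq hf hN hc, hc]

theorem IsCanonicalBasis.mem {P : ℕ → SmoothOp} (hB : IsCanonicalBasis E P) (k : ℕ) : P k ∈ E :=
  (show IsMinimalProjection E (P k) from hB.range_eq.le ⟨k, rfl⟩).mem

/-- The coefficients lie in the Köthe space, so the series has a sum `y ∈ E`. Since `x - y` is
killed by every `P_k`, and these are all the minimal projections, it vanishes. -/
theorem hasSum_blockCoeff (hE : IsInfDimClosedComm E) (hf : IsOrthonormalSeq f)
    (hN : ∀ k, (N k).Nonempty) (hd : Pairwise fun k l => Disjoint (N k) (N l))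
    (hB : IsCanonicalBasis E (blockProj f N)) {x : SmoothOp} (hx : x ∈ E) :
    HasSum (fun k => blockCoeff f hN x k • blockProj f N k) x := by
  have hxP := mul_blockProj_eq hE hf hN hB hx
  obtain ⟨y, hy, -⟩ := exists_hasSum_blockProj hf hN hd (blockCoeff_mem hf hN hxP)
  have hyE := mem_of_hasSum_blockProj hE.isClosed hB.mem hy
  have h : x - y = 0 := by
    refine eq_zero_of_mul_minimalProjection hE (sub_mem hx hyE) fun P hP => ?_
    obtain ⟨k, rfl⟩ := hB.range_eq.ge hP
    rw [sub_mul, hxP k, mul_blockProj_of_tendsto hf hd hy.tendsto_sum_nat k, sub_self]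
  rwa [← sub_eq_zero.1 h] at hy

theorem blockCoeff_of_hasSum (hf : IsOrthonormalSeq f) (hN : ∀ k, (N k).Nonempty)
    (hd : Pairwise fun k l => Disjoint (N k) (N l)) {c : ℕ → ℂ} {x : SmoothOp}
    (h : HasSum (fun k => c k • blockProj f N k) x) : blockCoeff f hN x = c :=
  funext fun k => blockCoeff_eq hf hN (mul_blockProj_of_tendsto hf hd h.tendsto_sum_nat k)

theorem isSchauderBasis_blockProj (hE : IsInfDimClosedComm E) (hf : IsOrthonormalSeq f)
    (hN : ∀ k, (N k).Nonempty) (hd : Pairwise fun k l => Disjoint (N k) (N l))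
    (hB : IsCanonicalBasis E (blockProj f N)) : IsSchauderBasis E (blockProj f N) where
  mem := hB.mem
  expansion x hx := ⟨blockCoeff f hN x, (hasSum_blockCoeff hE hf hN hd hB hx).tendsto_sum_nat,
    fun _ hc => funext fun k =>
      (blockCoeff_eq hf hN (mul_blockProj_of_tendsto hf hd hc k)).symm⟩

/-- The isomorphism `E ≅ λ^∞(max_{j ∈ N_k} |f_j|_q)`. -/
def kotheEquiv (hE : IsInfDimClosedComm E) (hf : IsOrthonormalSeq f)
    (hN : ∀ k, (N k).Nonempty) (hd : Pairwise fun k l => Disjoint (N k) (N l))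
    (hB : IsCanonicalBasis E (blockProj f N)) : E ≃⋆ₐ[ℂ] KotheSpace (maxMatrix f hf N hN) where
  toFun x := ⟨blockCoeff f hN x, blockCoeff_mem hf hN (mul_blockProj_eq hE hf hN hB x.2)⟩
  invFun c := ⟨(exists_hasSum_blockProj hf hN hd c.2).choose,
    mem_of_hasSum_blockProj hE.isClosed hB.mem (exists_hasSum_blockProj hf hN hd c.2).choose_spec.1⟩
  left_inv x := Subtype.ext <| HasSum.unique
    (exists_hasSum_blockProj hf hN hd
      (blockCoeff_mem hf hN (mul_blockProj_eq hE hf hN hB x.2))).choose_spec.1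
    (hasSum_blockCoeff hE hf hN hd hB x.2)
  right_inv c := Subtype.ext <| blockCoeff_of_hasSum hf hN hd
    (exists_hasSum_blockProj hf hN hd c.2).choose_spec.1
  map_mul' x y := Subtype.ext <| funext fun k => blockCoeff_eq hf hN <| by
    have h : ((x * y : E) : SmoothOp) = x * y := rfl
    rw [h, mul_assoc, mul_blockProj_eq hE hf hN hB y.2, mul_smul_smoothOp,
      mul_blockProj_eq hE hf hN hB x.2, smul_smul, mul_comm]
    rfl
  map_add' x y := Subtype.ext <| blockCoeff_add hN (x : SmoothOp) y
  map_star' x := Subtype.ext <| funext fun k => blockCoeff_star hN (x : SmoothOp) k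
  map_smul' c x := Subtype.ext <| blockCoeff_smul hN c (x : SmoothOp)

theorem hasSum_kotheEquiv_symm (hE : IsInfDimClosedComm E) (hf : IsOrthonormalSeq f)
    (hN : ∀ k, (N k).Nonempty) (hd : Pairwise fun k l => Disjoint (N k) (N l))
    (hB : IsCanonicalBasis E (blockProj f N)) (c : KotheSpace (maxMatrix f hf N hN)) :
    HasSum (fun k => (c : ℕ → ℂ) k • blockProj f N k)
      ((kotheEquiv hE hf hN hd hB).symm c : SmoothOp) :=
  (exists_hasSum_blockProj hf hN hd c.2).choose_spec.1

theorem norm_weightedOp_le_of_hasSum (hf : IsOrthonormalSeq f) (hN : ∀ k, (N k).Nonempty)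
    (hd : Pairwise fun k l => Disjoint (N k) (N l)) {c : ℕ → ℂ}
    (hc : c ∈ kotheSubmodule (maxMatrix f hf N hN)) {y : SmoothOp}
    (hy : HasSum (fun k => c k • blockProj f N k) y) {q : ℕ} {M : ℝ}
    (hM : ∀ k, ‖c k‖ * (maxMatrix f hf N hN).entry k (4 * q + 4) ≤ M) :
    ‖weightedOp q y‖ ≤ M * ∑' i : ℕ, 1 / ((i : ℝ) + 1) ^ 2 := by
  obtain ⟨z, hz, h⟩ := exists_hasSum_blockProj hf hN hd hc
  rw [hy.unique hz]
  exact h q M hM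

theorem continuous_kotheEquiv (hE : IsInfDimClosedComm E) (hf : IsOrthonormalSeq f)
    (hN : ∀ k, (N k).Nonempty) (hd : Pairwise fun k l => Disjoint (N k) (N l))
    (hB : IsCanonicalBasis E (blockProj f N)) : Continuous (kotheEquiv hE hf hN hd hB) := by
  let g : E.toNonUnitalSubalgebra.toSubmodule →ₗ[ℂ] KotheSpace (maxMatrix f hf N hN) :=
    { toFun := kotheEquiv hE hf hN hd hB
      map_add' := map_add (kotheEquiv hE hf hN hd hB)
      map_smul' := map_smul (kotheEquiv hE hf hN hd hB) }
  change Continuous g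
  refine (withSeminorms_kothe _).continuous_of_continuous_comp g fun q => ?_
  have hcont : Continuous fun x : E.toNonUnitalSubalgebra.toSubmodule =>
      ‖weightedOp q (x : SmoothOp)‖ :=
    ((weightedOp q).continuous.comp continuous_subtype_val).norm
  refine Seminorm.continuous_of_le (q := (normSeminorm ℂ (L2 →L[ℂ] L2)).comp
    ((weightedOp q).toLinearMap.comp E.toNonUnitalSubalgebra.toSubmodule.subtype)) hcont fun x => ?_
  refine ciSup_le fun k => norm_mul_entry_le hf hN (fun j hj => ?_) q
  exact iota_eq_smul_of_mul_blockProj hf (mul_blockProj_eq hE hf hN hB x.2 k) hj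

/-- Here the index rises from `q` to `4q + 4`, whereas `continuous_kotheEquiv` keeps the same `q`.
-/
theorem continuous_kotheEquiv_symm (hE : IsInfDimClosedComm E) (hf : IsOrthonormalSeq f)
    (hN : ∀ k, (N k).Nonempty) (hd : Pairwise fun k l => Disjoint (N k) (N l))
    (hB : IsCanonicalBasis E (blockProj f N)) :
    Continuous (kotheEquiv hE hf hN hd hB).symm := by
  refine Continuous.subtype_mk (f := fun c => ((kotheEquiv hE hf hN hd hB).symm c : SmoothOp))
    ?_ fun c => ((kotheEquiv hE hf hN hd hB).symm c).2
  rw [continuous_smoothOp_iff]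
  intro q
  let g : KotheSpace (maxMatrix f hf N hN) →ₗ[ℂ] (L2 →L[ℂ] L2) :=
    (weightedOp q).toLinearMap.comp (show KotheSpace (maxMatrix f hf N hN) →ₗ[ℂ] SmoothOp from
      { toFun := fun c => ((kotheEquiv hE hf hN hd hB).symm c : SmoothOp)
        map_add' := fun c d => congrArg Subtype.val (map_add (kotheEquiv hE hf hN hd hB).symm c d)
        map_smul' := fun r c =>
          congrArg Subtype.val (map_smul (kotheEquiv hE hf hN hd hB).symm r c) })
  change Continuous g
  refine WithSeminorms.continuous_normedSpace_rng (L2 →L[ℂ] L2) (withSeminorms_kothe _) g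
    ⟨{4 * q + 4}, ⟨∑' i : ℕ, 1 / ((i : ℝ) + 1) ^ 2, tsum_nonneg fun i => by positivity⟩,
      fun c => ?_⟩
  rw [Finset.sup_singleton]
  refine (norm_weightedOp_le_of_hasSum hf hN hd c.2 (hasSum_kotheEquiv_symm hE hf hN hd hB c)
    fun k => le_ciSup (c.2 (4 * q + 4)) k).trans (le_of_eq ?_)
  exact mul_comm _ _

theorem isoVia_blockProj (hE : IsInfDimClosedComm E) (hf : IsOrthonormalSeq f)
    (hN : ∀ k, (N k).Nonempty) (hd : Pairwise fun k l => Disjoint (N k) (N l))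
    (hB : IsCanonicalBasis E (blockProj f N)) :
    IsoVia E (blockProj f N) (maxMatrix f hf N hN) := by
  refine ⟨kotheEquiv hE hf hN hd hB, ?_, fun k => ⟨hB.mem k, ?_⟩⟩
  · exact (Homeomorph.mk (kotheEquiv hE hf hN hd hB).toEquiv
      (continuous_kotheEquiv hE hf hN hd hB)
      (continuous_kotheEquiv_symm hE hf hN hd hB)).isHomeomorph
  · refine Subtype.ext (funext fun l => blockCoeff_eq hf hN ?_)
    change blockProj f N k * _ = (Pi.single k (1 : ℂ) : ℕ → ℂ) l • _
    rcases eq_or_ne l k with rfl | h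
    · rw [Pi.single_eq_same, one_smul, blockProj_mul_self hf]
    · rw [Pi.single_eq_of_ne h, zero_smul, blockProj_mul_of_ne hf hd h.symm]

/-! ### The algebra generated by the blocks -/

theorem hasSum_blockProj_single (f : ℕ → SSpace) (N : ℕ → Finset ℕ) (k : ℕ) :
    HasSum (fun l => (Pi.single k (1 : ℂ) : ℕ → ℂ) l • blockProj f N l) (blockProj f N k) := by
  convert! hasSum_single (f := fun l => (Pi.single k (1 : ℂ) : ℕ → ℂ) l • blockProj f N l) k
    (fun l hl => by rw [Pi.single_eq_of_ne hl, zero_smul]) using 1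
  rw [Pi.single_eq_same, one_smul]

theorem hasSum_mul (hf : IsOrthonormalSeq f)
    (hd : Pairwise fun k l => Disjoint (N k) (N l)) {c d : ℕ → ℂ} {x y : SmoothOp}
    (hx : HasSum (fun k => c k • blockProj f N k) x)
    (hy : HasSum (fun k => d k • blockProj f N k) y) :
    HasSum (fun k => (d k * c k) • blockProj f N k) (x * y) := by
  have h1 : HasSum (fun k => x * (d k • blockProj f N k)) (x * y) :=
    hy.mapL (ContinuousLinearMap.postcomp SDual (x.comp (j₂.comp j₁)))
  have h2 : ∀ k, x * (d k • blockProj f N k) = (d k * c k) • blockProj f N k := fun k => by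
    rw [mul_smul_smoothOp, mul_blockProj_of_tendsto hf hd hx.tendsto_sum_nat, smul_smul]
  simpa only [h2] using h1

/-- The conjugate coefficients lie in the same Köthe space, so their series converges to some `y` in
`L(s', s)`. The identity `star x = y` is then read off in `L(ℓ²)`, where the adjoint is continuous.
-/
theorem hasSum_star {c : ℕ → ℂ} {x : SmoothOp} (hf : IsOrthonormalSeq f)
    (hN : ∀ k, (N k).Nonempty) (hd : Pairwise fun k l => Disjoint (N k) (N l))
    (hx : HasSum (fun k => c k • blockProj f N k) x) :
    HasSum (fun k => conj (c k) • blockProj f N k) (star x) := by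
  have hxP : ∀ k, x * blockProj f N k = blockCoeff f hN x k • blockProj f N k := fun k => by
    rw [blockCoeff_of_hasSum hf hN hd hx, mul_blockProj_of_tendsto hf hd hx.tendsto_sum_nat]
  have hc : c ∈ kotheSubmodule (maxMatrix f hf N hN) :=
    blockCoeff_of_hasSum hf hN hd hx ▸ blockCoeff_mem hf hN hxP
  obtain ⟨y, hy, -⟩ := exists_hasSum_blockProj hf hN hd (c := fun k => conj (c k))
    (fun q => by simpa using hc q)
  have h1 : HasSum (fun k => iota (c k • blockProj f N k)) (iota x) := by
    simp only [← weightedOp_zero]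
    exact hx.mapL (weightedOp 0)
  have h2 : HasSum (fun k => iota (conj (c k) • blockProj f N k)) (iota y) := by
    simp only [← weightedOp_zero]
    exact hy.mapL (weightedOp 0)
  have h3 : HasSum (fun k => star (iota (c k • blockProj f N k))) (star (iota x)) := h1.star
  have h4 : ∀ k, star (iota (c k • blockProj f N k)) = iota (conj (c k) • blockProj f N k) := by
    intro k
    rw [ContinuousLinearMap.star_eq_adjoint, ← iota_star, star_smul_smoothOp, star_blockProj]
  simp only [h4] at h3
  have h5 : star x = y := iota_injective (by rw [iota_star]; exact h3.unique h2)
  rwa [h5]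

/-- The operators `∑ c_k P_k`, where `P_k` are the projections associated with the blocks. -/
def blockAlgebra (hf : IsOrthonormalSeq f) (hN : ∀ k, (N k).Nonempty)
    (hd : Pairwise fun k l => Disjoint (N k) (N l)) : NonUnitalStarSubalgebra ℂ SmoothOp where
  carrier := {x | ∃ c : ℕ → ℂ, HasSum (fun k => c k • blockProj f N k) x}
  zero_mem' := ⟨0, by simp⟩
  add_mem' := by
    rintro x y ⟨c, hc⟩ ⟨d, hd⟩
    exact ⟨c + d, by simpa only [Pi.add_apply, add_smul] using hc.add hd⟩
  smul_mem' := by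
    rintro r x ⟨c, hc⟩
    exact ⟨r • c, by simpa only [Pi.smul_apply, smul_eq_mul, mul_smul] using hc.const_smul r⟩
  mul_mem' := by
    rintro x y ⟨c, hx⟩ ⟨d, hy⟩
    exact ⟨_, hasSum_mul hf hd hx hy⟩
  star_mem' := by
    rintro x ⟨c, hx⟩
    exact ⟨_, hasSum_star hf hN hd hx⟩

theorem blockProj_mem_blockAlgebra (hf : IsOrthonormalSeq f) (hN : ∀ k, (N k).Nonempty)
    (hd : Pairwise fun k l => Disjoint (N k) (N l)) (k : ℕ) :
    blockProj f N k ∈ blockAlgebra hf hN hd :=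
  ⟨_, hasSum_blockProj_single f N k⟩

theorem isClosed_blockAlgebra (hf : IsOrthonormalSeq f) (hN : ∀ k, (N k).Nonempty)
    (hd : Pairwise fun k l => Disjoint (N k) (N l)) :
    IsClosed (blockAlgebra hf hN hd : Set SmoothOp) := by
  let D : Set SmoothOp :=
    {x | ∀ k, x * blockProj f N k = blockCoeff f hN x k • blockProj f N k}
  have hD : IsClosed D := by
    have : D = ⋂ k, {x | x * blockProj f N k = blockCoeff f hN x k • blockProj f N k} := by
      ext x; simp [D]
    rw [this]
    refine isClosed_iInter fun k => isClosed_eq ?_ ?_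
    · exact (ContinuousLinearMap.precomp SSpace
        ((j₂.comp j₁).comp (blockProj f N k))).continuous
    · exact (continuous_blockCoeff hN k).smul continuous_const
  have hsub : (blockAlgebra hf hN hd : Set SmoothOp) ⊆ D := by
    rintro x ⟨c, hx⟩ k
    rw [blockCoeff_of_hasSum hf hN hd hx, mul_blockProj_of_tendsto hf hd hx.tendsto_sum_nat]
  -- Membership of `x` in `D` alone is not enough, as it leaves the action of `x` off the span of
  -- the blocks undetermined. It does make the block series of `x` converge to some `y`. For `z` in
  -- the algebra, the two estimates applied to `z - x` and `z - y`, which have the same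
  -- coefficients, show that `z → x` forces `z → y`; hence `x = y`.
  refine isClosed_of_closure_subset fun x hx => ?_
  have hxD : x ∈ D := hD.closure_subset_iff.2 hsub hx
  obtain ⟨y, hy, -⟩ := exists_hasSum_blockProj hf hN hd (blockCoeff_mem hf hN hxD)
  have : (𝓝[(blockAlgebra hf hN hd : Set SmoothOp)] x).NeBot :=
    mem_closure_iff_nhdsWithin_neBot.1 hx
  have hxlim : Tendsto id (𝓝[(blockAlgebra hf hN hd : Set SmoothOp)] x) (𝓝 x) :=
    nhdsWithin_le_nhds
  have hylim : Tendsto id (𝓝[(blockAlgebra hf hN hd : Set SmoothOp)] x) (𝓝 y) := by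
    refine tendsto_smoothOp_iff.2 fun q => ?_
    rw [tendsto_iff_norm_sub_tendsto_zero]
    have hbound : ∀ᶠ z in 𝓝[(blockAlgebra hf hN hd : Set SmoothOp)] x,
        ‖weightedOp q (id z) - weightedOp q y‖ ≤
          ‖weightedOp (4 * q + 4) (id z) - weightedOp (4 * q + 4) x‖ *
            ∑' i : ℕ, 1 / ((i : ℝ) + 1) ^ 2 := by
      filter_upwards [self_mem_nhdsWithin] with z hz
      have hzD := hsub hz
      obtain ⟨c, hc⟩ := hz
      have hcz := blockCoeff_of_hasSum hf hN hd hc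
      rw [← hcz] at hc
      have hsum : HasSum (fun k => (blockCoeff f hN z - blockCoeff f hN x) k • blockProj f N k)
          (z - y) := by
        simpa only [Pi.sub_apply, sub_smul] using hc.sub hy
      have hmul : ∀ k, (z - x) * blockProj f N k =
          (blockCoeff f hN z - blockCoeff f hN x) k • blockProj f N k := fun k => by
        rw [sub_mul, hzD k, hxD k, Pi.sub_apply, sub_smul]
      rw [← map_sub, ← map_sub]
      exact norm_weightedOp_le_of_hasSum hf hN hd
        (Submodule.sub_mem _ (blockCoeff_mem hf hN hzD) (blockCoeff_mem hf hN hxD)) hsum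
        fun k => norm_mul_entry_le hf hN
          (fun j hj => iota_eq_smul_of_mul_blockProj hf (hmul k) hj) _
    refine squeeze_zero' (Eventually.of_forall fun z => norm_nonneg _) hbound ?_
    have h1 := tendsto_iff_norm_sub_tendsto_zero.1 (tendsto_smoothOp_iff.1 hxlim (4 * q + 4))
    simpa only [zero_mul] using h1.mul_const (∑' i : ℕ, 1 / ((i : ℝ) + 1) ^ 2)
  rw [tendsto_nhds_unique hxlim hylim]
  exact ⟨_, hy⟩

theorem linearIndependent_blockProj (hf : IsOrthonormalSeq f) (hN : ∀ k, (N k).Nonempty)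
    (hd : Pairwise fun k l => Disjoint (N k) (N l)) : LinearIndependent ℂ (blockProj f N) := by
  rw [linearIndependent_iff']
  intro s g hg k hk
  have h1 := congrArg (· * blockProj f N k) hg
  simp only [Finset.sum_mul, zero_mul] at h1
  rw [Finset.sum_eq_single k] at h1
  · rw [smul_mul_smoothOp, blockProj_mul_self hf] at h1
    exact (smul_eq_zero.1 h1).resolve_right (blockProj_ne_zero hf hN k)
  · intro l _ hlk
    rw [smul_mul_smoothOp, blockProj_mul_of_ne hf hd hlk, smul_zero]
  · exact fun h => absurd hk h

theorem isInfDimClosedComm_blockAlgebra (hf : IsOrthonormalSeq f) (hN : ∀ k, (N k).Nonempty)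
    (hd : Pairwise fun k l => Disjoint (N k) (N l)) :
    IsInfDimClosedComm (blockAlgebra hf hN hd) where
  infinite_dimensional := by
    intro hfin
    have hfin' : FiniteDimensional ℂ
        (blockAlgebra hf hN hd).toNonUnitalSubalgebra.toSubmodule := hfin
    let v : ℕ → (blockAlgebra hf hN hd).toNonUnitalSubalgebra.toSubmodule :=
      fun k => ⟨blockProj f N k, blockProj_mem_blockAlgebra hf hN hd k⟩
    have hv : LinearIndependent ℂ v :=
      LinearIndependent.of_comp (Submodule.subtype _) (linearIndependent_blockProj hf hN hd)
    have := hv.finite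
    exact not_finite ℕ
  isClosed := isClosed_blockAlgebra hf hN hd
  comm := by
    rintro x ⟨c, hx⟩ y ⟨d, hy⟩
    refine (hasSum_mul hf hd hx hy).unique ?_
    simpa only [mul_comm] using hasSum_mul hf hd hy hx

theorem isCanonicalBasis_blockAlgebra (hf : IsOrthonormalSeq f) (hN : ∀ k, (N k).Nonempty)
    (hd : Pairwise fun k l => Disjoint (N k) (N l)) :
    IsCanonicalBasis (blockAlgebra hf hN hd) (blockProj f N) where
  injective := (linearIndependent_blockProj hf hN hd).injective
  range_eq := by
    refine Set.Subset.antisymm ?_ fun Q hQ => ?_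
    · rintro _ ⟨k, rfl⟩
      refine ⟨blockProj_mem_blockAlgebra hf hN hd k, isStarProjection_blockProj hf k,
        blockProj_ne_zero hf hN k, fun Q hQ hQs hQP _ => ?_⟩
      obtain ⟨c, hc⟩ := hQ
      have h1 : Q = c k • blockProj f N k :=
        hQP.symm.trans (mul_blockProj_of_tendsto hf hd hc.tendsto_sum_nat k)
      by_cases h0 : c k = 0
      · left
        rw [h1, h0, zero_smul]
      right
      have h2 : Q * Q = Q := hQs.isIdempotentElem
      nth_rewrite 2 [h1] at h2
      rw [mul_smul_smoothOp, hQP] at h2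
      nth_rewrite 2 [h1] at h2
      exact smul_right_injective _ h0 h2
    · obtain ⟨c, hc⟩ := hQ.mem
      have hQP := mul_blockProj_of_tendsto hf hd hc.tendsto_sum_nat
      obtain ⟨k, hk⟩ : ∃ k, c k ≠ 0 := by
        by_contra! hcon
        simp only [hcon, zero_smul] at hc
        exact hQ.ne_zero (hc.unique hasSum_zero)
      have hcomm := (isInfDimClosedComm_blockAlgebra hf hN hd).comm Q hQ.mem _
        (blockProj_mem_blockAlgebra hf hN hd k)
      -- Idempotence of `Q` gives `c_k² = c_k`, so `c_k = 1` and the block lies below `Q`;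
      -- minimality of `Q` then forces equality.
      have h1 : Q * blockProj f N k = blockProj f N k := by
        have h2 : Q * (Q * blockProj f N k) = Q * blockProj f N k := by
          rw [← mul_assoc, hQ.isStarProjection.isIdempotentElem]
        nth_rewrite 1 [hQP k] at h2
        rw [mul_smul_smoothOp] at h2
        nth_rewrite 2 [hQP k] at h2
        exact smul_right_injective _ hk h2
      exact ⟨k, (hQ.minimal _ (blockProj_mem_blockAlgebra hf hN hd k)
        (isStarProjection_blockProj hf k) (hcomm.symm.trans h1) h1).resolve_left
          (blockProj_ne_zero hf hN k)⟩

end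

section

/-! ### Enumeration of the minimal projections -/

/-- By Bessel, each coordinate `i` is nonzero for only countably many vectors of the family, and
every vector has a nonzero coordinate. -/
theorem countable_of_orthonormal {ι : Type*} {u : ι → L2} (hu : Orthonormal ℂ u) :
    Countable ι := by
  have h1 : ∀ i : ℕ, (Function.support fun a => ‖(u a : ℕ → ℂ) i‖ ^ 2).Countable := by
    intro i
    have h2 := hu.inner_products_summable (lp.single 2 i (1 : ℂ) : L2)
    refine (h2.congr fun a => ?_).countable_support
    rw [lp.inner_single_right]
    simp
  have h2 : (Set.univ : Set ι) ⊆ ⋃ i : ℕ, Function.support fun a => ‖(u a : ℕ → ℂ) i‖ ^ 2 := by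
    intro a _
    have h3 : u a ≠ 0 := hu.ne_zero a
    by_contra hcon
    refine h3 (Subtype.ext (funext fun i => ?_))
    have h4 : a ∉ Function.support fun a => ‖(u a : ℕ → ℂ) i‖ ^ 2 := fun h =>
      hcon (Set.mem_iUnion.2 ⟨i, h⟩)
    have h5 := Function.notMem_support.1 h4
    simpa using h5
  exact Set.countable_univ_iff.1 ((Set.countable_iUnion h1).mono h2)

variable {E : NonUnitalStarSubalgebra ℂ SmoothOp}

/-- By commutativity `P Q` is a projection below both; were it nonzero, it would equal both. -/
theorem IsMinimalProjection.mul_eq_zero (hE : IsInfDimClosedComm E) {P Q : SmoothOp}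
    (hP : IsMinimalProjection E P) (hQ : IsMinimalProjection E Q) (h : P ≠ Q) : P * Q = 0 := by
  have hPP : P * P = P := hP.isStarProjection.isIdempotentElem
  have hQQ : Q * Q = Q := hQ.isStarProjection.isIdempotentElem
  have hc : P * Q = Q * P := hE.comm P hP.mem Q hQ.mem
  have hmem : P * Q ∈ E := mul_mem hP.mem hQ.mem
  have hs : IsStarProjection (P * Q) := by
    refine ⟨?_, ?_⟩
    · change P * Q * (P * Q) = P * Q
      rw [mul_assoc, ← mul_assoc Q, ← hc, mul_assoc P Q Q, hQQ, ← mul_assoc, hPP]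
    · change star (P * Q) = P * Q
      rw [star_mul_smoothOp, hP.isStarProjection.isSelfAdjoint, hQ.isStarProjection.isSelfAdjoint,
        hc]
  have h1 : P * (P * Q) = P * Q := by rw [← mul_assoc, hPP]
  have h2 : P * Q * Q = P * Q := by rw [mul_assoc, hQQ]
  have h3 : P * Q * P = P * Q := by rw [hc, mul_assoc, hPP]
  have h4 : Q * (P * Q) = P * Q := by rw [hc, ← mul_assoc, hQQ]
  rcases hP.minimal _ hmem hs h3 h1 with h5 | h5
  · exact h5
  rcases hQ.minimal _ hmem hs h2 h4 with h6 | h6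
  · exact h6
  exact absurd (h5.symm.trans h6) h

/-- With finitely many minimal projections, `x - ∑ c_P P` would be killed by all of them, so they
would span `E`. -/
theorem infinite_minimalProjections (hE : IsInfDimClosedComm E) :
    Infinite {P | IsMinimalProjection E P} := by
  classical
  refine not_finite_iff_infinite.1 fun hfin => hE.infinite_dimensional ?_
  have hfin' : {P | IsMinimalProjection E P}.Finite := hfin
  suffices h : FiniteDimensional ℂ E.toNonUnitalSubalgebra.toSubmodule from h
  have := FiniteDimensional.span_of_finite ℂ hfin'
  refine Submodule.finiteDimensional_of_le
    (S₂ := Submodule.span ℂ {P | IsMinimalProjection E P}) fun x hx => ?_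
  have hx : x ∈ E := hx
  have hex : ∀ P, ∃ c : ℂ, IsMinimalProjection E P → x * P = c • P := fun P => by
    by_cases hP : IsMinimalProjection E P
    · obtain ⟨c, hc⟩ := exists_smul_of_isMinimalProjection hE hx hP
      exact ⟨c, fun _ => hc⟩
    · exact ⟨0, fun h => absurd h hP⟩
  choose c hc using hex
  have hmem : ∀ P ∈ hfin'.toFinset, IsMinimalProjection E P := fun P hP =>
    hfin'.mem_toFinset.1 hP
  have h1 : x - ∑ P ∈ hfin'.toFinset, c P • P = 0 := by
    refine eq_zero_of_mul_minimalProjection hE (sub_mem hx (sum_mem fun P hP =>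
      SMulMemClass.smul_mem _ (hmem P hP).mem)) fun Q hQ => ?_
    rw [sub_mul, Finset.sum_mul, Finset.sum_eq_single Q, hc Q hQ, smul_mul_smoothOp,
      hQ.isStarProjection.isIdempotentElem, sub_self]
    · intro P hP hPQ
      rw [smul_mul_smoothOp, (hmem P hP).mul_eq_zero hE hQ hPQ, smul_zero]
    · exact fun h => absurd (hfin'.mem_toFinset.2 hQ) h
  rw [sub_eq_zero.1 h1]
  exact Submodule.sum_mem _ fun P hP => Submodule.smul_mem _ _ (Submodule.subset_span (hmem P hP))

/-- A projection in `L(s', s)` is a finite sum of projections onto orthonormal vectors in `s`. -/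
theorem exists_orthonormal_eq_sum {P : SmoothOp} (hP : IsStarProjection P) (hP0 : P ≠ 0) :
    ∃ (n : ℕ) (v : Fin (n + 1) → SSpace), Orthonormal ℂ (fun i => j₁ (v i)) ∧
      (∀ i, iota P (j₁ (v i)) = j₁ (v i)) ∧ P = ∑ i, rankOne (v i) := by
  have hPι := isStarProjection_iff_iota.1 hP
  have hfin := finiteDimensional_range_iota hP.isIdempotentElem
  obtain ⟨hproj, hrange⟩ := isStarProjection_iff_eq_starProjection_range.1 hPι
  have hne : Module.finrank ℂ (iota P).range ≠ 0 := by
    intro h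
    have h1 : (iota P).range = ⊥ := Submodule.finrank_eq_zero.1 h
    refine hP0 (iota_injective ?_)
    rw [iota_zero]
    ext1 ξ
    have h2 : iota P ξ ∈ (iota P).range := ⟨ξ, rfl⟩
    rw [h1, Submodule.mem_bot] at h2
    rw [h2, zero_apply]
  obtain ⟨n, hn⟩ := Nat.exists_eq_succ_of_ne_zero hne
  let b : OrthonormalBasis (Fin (n + 1)) ℂ (iota P).range :=
    (stdOrthonormalBasis ℂ (iota P).range).reindex (finCongr hn)
  have hb : ∀ i, iota P (b i : L2) = b i := by
    intro i
    obtain ⟨ξ, hξ⟩ := (b i).2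
    rw [← hξ]
    exact congrArg (fun T : L2 →L[ℂ] L2 => T ξ) hPι.isIdempotentElem
  -- The basis vectors are fixed by `P`, which maps into `s`; so they already belong to `s`.
  have hv : ∀ i, j₁ (P (j₂ (b i : L2))) = b i := hb
  refine ⟨n, fun i => P (j₂ (b i : L2)), ?_, fun i => ?_, iota_injective ?_⟩
  · simp only [hv]
    exact b.orthonormal.comp_linearIsometry (iota P).range.subtypeₗᵢ
  · rw [hv, hb]
  · have h1 : iota (∑ i, rankOne (P (j₂ (b i : L2)))) =
        ∑ i, InnerProductSpace.rankOne ℂ (b i : L2) (b i : L2) := by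
      rw [← weightedOp_zero, map_sum]
      exact Finset.sum_congr rfl fun i _ => by rw [weightedOp_zero, iota_rankOne, hv]
    rw [h1, ← b.starProjection_eq_sum_rankOne]
    exact hrange

/-- Orthonormal bases of the ranges of all minimal projections form one orthonormal family, since
distinct minimal projections multiply to zero. Both this family and the set of projections are
countably infinite; after enumerating each by `ℕ`, `N k` collects the indices of the basis vectors
belonging to the `k`-th projection. -/
theorem exists_canonicalBasis (hE : IsInfDimClosedComm E) :
    ∃ (f : ℕ → SSpace) (_ : IsOrthonormalSeq f) (N : ℕ → Finset ℕ),
      (∀ k, (N k).Nonempty) ∧ (Pairwise fun k l => Disjoint (N k) (N l)) ∧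
        IsCanonicalBasis E (blockProj f N) := by
  classical
  let M : Set SmoothOp := {P | IsMinimalProjection E P}
  have hM : Infinite M := infinite_minimalProjections hE
  choose n v hv hfix hsum using fun P : M =>
    exists_orthonormal_eq_sum P.2.isStarProjection P.2.ne_zero
  let I : Type := Σ P : M, Fin (n P + 1)
  let u : I → SSpace := fun a => v a.1 a.2
  have hu : Orthonormal ℂ fun a => j₁ (u a) := by
    refine ⟨fun a => (hv a.1).1 a.2, ?_⟩
    rintro ⟨P, i⟩ ⟨Q, l⟩ hne
    by_cases hPQ : P = Q
    · subst hPQ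
      exact (hv P).2 fun h => hne (congrArg (Sigma.mk P) h)
    · have h1 : (P : SmoothOp) * Q = 0 :=
        P.2.mul_eq_zero hE Q.2 fun h => hPQ (Subtype.ext h)
      have h2 : iota (P : SmoothOp) (iota (Q : SmoothOp) (j₁ (v Q l))) = 0 := by
        have h3 := congrArg (fun z => iota z (j₁ (v Q l))) h1
        simp only [iota_zero] at h3
        exact h3
      change inner ℂ (j₁ (v P i)) (j₁ (v Q l)) = 0
      have h4 : iota (P : SmoothOp) = ContinuousLinearMap.adjoint (iota (P : SmoothOp)) := by
        rw [← iota_star]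
        exact congrArg iota P.2.isStarProjection.isSelfAdjoint.symm
      have h5 : inner ℂ (j₁ (v P i)) (j₁ (v Q l)) =
          inner ℂ (j₁ (v P i)) (iota (P : SmoothOp) (iota (Q : SmoothOp) (j₁ (v Q l)))) := by
        rw [h4, ContinuousLinearMap.adjoint_inner_right, hfix P i, hfix Q l]
      rw [h5, h2, inner_zero_right]
  have hI : Countable I := countable_of_orthonormal hu
  have hMc : Countable M :=
    Function.Injective.countable (f := fun P : M => (⟨P, 0⟩ : I)) fun P Q h => congrArg Sigma.fst h
  have hIinf : Infinite I :=
    Infinite.of_injective (fun P : M => (⟨P, 0⟩ : I)) fun P Q h => congrArg Sigma.fst h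
  obtain ⟨e⟩ : Nonempty (ℕ ≃ I) := nonempty_equiv_of_countable
  obtain ⟨g⟩ : Nonempty (ℕ ≃ M) := nonempty_equiv_of_countable
  let emb : ∀ k, Fin (n (g k) + 1) ↪ ℕ := fun k =>
    (Function.Embedding.sigmaMk (g k)).trans e.symm.toEmbedding
  let N : ℕ → Finset ℕ := fun k => Finset.univ.map (emb k)
  have hblock : ∀ k, blockProj (fun m => u (e m)) N k = g k := by
    intro k
    rw [blockProj, Finset.sum_map, hsum (g k)]
    refine Finset.sum_congr rfl fun i _ => ?_
    change rankOne (u (e (e.symm ⟨g k, i⟩))) = _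
    rw [e.apply_symm_apply]
  refine ⟨fun m => u (e m), hu.comp e e.injective, N, fun k => ?_, fun k l hkl => ?_, ?_, ?_⟩
  · exact Finset.univ_nonempty.map
  · refine Finset.disjoint_left.2 ?_
    intro m hm hm'
    obtain ⟨i, -, rfl⟩ := Finset.mem_map.1 hm
    obtain ⟨i', -, h⟩ := Finset.mem_map.1 hm'
    have h1 := congrArg Sigma.fst (e.symm.injective h)
    exact hkl (g.injective h1.symm)
  · intro k l h
    rw [hblock, hblock] at h
    exact g.injective (Subtype.ext h)
  · ext Q
    constructor
    · rintro ⟨k, rfl⟩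
      rw [hblock]
      exact (g k).2
    · intro hQ
      refine ⟨g.symm ⟨Q, hQ⟩, ?_⟩
      rw [hblock, g.apply_symm_apply]

end

end SmoothOperators

end
-- The three assertions combined
open SmoothOperators in
theorem mainTheorem3 :
    -- every `E` is of this form
    (∀ E : NonUnitalStarSubalgebra ℂ SmoothOp, IsInfDimClosedComm E →
      ∃ (f : ℕ → SSpace) (hf : IsOrthonormalSeq f) (N : ℕ → Finset ℕ)
        (hN : ∀ k, (N k).Nonempty),
        Pairwise (fun k l => Disjoint (N k) (N l)) ∧
        IsCanonicalBasis E (blockProj f N) ∧ IsSchauderBasis E (blockProj f N) ∧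
        IsoVia E (blockProj f N) (maxMatrix f hf N hN)) ∧
    -- any representation of the canonical basis yields the isomorphism
    (∀ E : NonUnitalStarSubalgebra ℂ SmoothOp, IsInfDimClosedComm E →
      ∀ (f : ℕ → SSpace) (hf : IsOrthonormalSeq f) (N : ℕ → Finset ℕ)
        (hN : ∀ k, (N k).Nonempty),
        Pairwise (fun k l => Disjoint (N k) (N l)) →
        IsCanonicalBasis E (blockProj f N) →
        IsSchauderBasis E (blockProj f N) ∧
        IsoVia E (blockProj f N) (maxMatrix f hf N hN)) ∧
    -- conversely, all such Köthe algebras arise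
    (∀ (f : ℕ → SSpace) (hf : IsOrthonormalSeq f) (N : ℕ → Finset ℕ)
        (hN : ∀ k, (N k).Nonempty),
        Pairwise (fun k l => Disjoint (N k) (N l)) →
        ∃ E : NonUnitalStarSubalgebra ℂ SmoothOp, IsInfDimClosedComm E ∧
          IsCanonicalBasis E (blockProj f N) ∧ IsSchauderBasis E (blockProj f N) ∧
          IsoVia E (blockProj f N) (maxMatrix f hf N hN)) := by
  refine ⟨fun E hE => ?_, fun E hE f hf N hN hd hB => ?_, fun f hf N hN hd => ?_⟩
  · obtain ⟨f, hf, N, hN, hd, hB⟩ := exists_canonicalBasis hE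
    exact ⟨f, hf, N, hN, hd, hB, isSchauderBasis_blockProj hE hf hN hd hB,
      isoVia_blockProj hE hf hN hd hB⟩
  · exact ⟨isSchauderBasis_blockProj hE hf hN hd hB, isoVia_blockProj hE hf hN hd hB⟩
  · have hE := isInfDimClosedComm_blockAlgebra hf hN hd
    have hB := isCanonicalBasis_blockAlgebra hf hN hd
    exact ⟨blockAlgebra hf hN hd, hE, hB, isSchauderBasis_blockProj hE hf hN hd hB,
      isoVia_blockProj hE hf hN hd hB⟩
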